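/- Let $\mathbb{ZF}$ be the syntactic category of first-order Zermelo–Fraenkel set theory $ZF$ (axioms: extensionality, separation, pairing, union, power set, replacement, infinity, foundation). Its objects are formulas in context $\{x_1,\dots,x_n\mid P\}$, and an arrow $\{\mathbf x\mid P\}\to\{\mathbf y\mid Q\}$ is a class $[\{\mathbf x,\mathbf y\mid F\}]$, modulo $ZF$-provable equivalence, of formulas $F(\mathbf x,\mathbf y)$ such that $F\vdash_{ZF}P(\mathbf x)\wedge Q(\mathbf y)$, $F(\mathbf x,\mathbf y)\wedge F(\mathbf x,\mathbf y')\vdash_{ZF}\mathbf y=\mathbf y'$ and $P\vdash_{ZF}\exists\mathbf y\,F$; composition is composition of relations. Let $\mathbb{DCL}[ZF]$ be the full subcategory on the objects $\{x\mid P\}$ with exactly one variable; it has finite limits. Let $\mathcal S$ be the class of arrows (the small maps) $[\{x,y\mid F\}]$ of $\mathbb{DCL}[ZF]$ with $\vdash_{ZF}\forall y\,\exists z\,\forall x\,(F(x,y)\leftrightarrow x\in z)$. Definitions, for a category $\mathbb C$ with finite limits and a class $\mathcal S$ of arrows. An object $U$ is *universal* if every object admits a mono into $U$. An object $\mathcal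 P_{\mathcal S}(X)$ is one equipped with a mono $e_X:{\in_X}\to X\times\mathcal P_{\mathcal S}(X)$ with $\pi_2 e_X\in\mathcal S$, such that for every mono $\psi:R\to X\times Z$ with $\pi_2\psi\in\mathcal S$ there is a unique $\rho:Z\to\mathcal P_{\mathcal S}(X)$ for which $\psi$ is a pullback of $e_X$ along $\mathrm{id}_X\times\rho$. An object $U$ is a *universe* if $\mathcal P_{\mathcal S}(U)$ exists and there is a mono $\mathcal P_{\mathcal S}(U)\to U$. A *ZF-algebra* is an internal sup-semilattice $(U,\subseteq)$ (an internal partial order with internal least element and binary suprema) with an arrow $\sigma:U\to U$, such that for every $j:B\to A$ in $\mathcal S$ and every $\lambda:B\to U$ there is $\sup_j(\lambda):A\to U$ such that, for all $j':B'\to A$ and $\lambda':B'\to U$, with $\pi_1:P\to B'$ and $\pi_2:P\to B$ the pullback of $j'$ and $j$, $$\textstyle\sup_j(\lambda)\circ j'\subseteq\lambda'\iff\lambda\circ\pi_2\subseteq\lambda'\circ\pi_1 .$$ Morphisms of ZF-algebras are morphisms of internal sup-semilattices that preserve $\sup_j(\lambda)$ for $j\in\mathcal S$ and commute with the arrows $\sigma$.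 **Claim.** In $\mathbb{DCL}[ZF]$ with small maps $\mathcal S$: 1. $V=\{x\mid x=x\}$ is a universal object. 2. $V$ is a universe. 3. $V$ with the subset relation, i.e. $\{z\mid\exists y\exists y'(z=\langle y,y'\rangle\wedge y\subseteq y')\}\to V\times V$, and with $\sigma=[\{x,z\mid z=\{x\}\}]:V\to V$, is a ZF-algebra, and it is an initial object of the category of ZF-algebras. 4. Suprema in it are given by unions: if $j=[\{z,z'\mid F\}]:\{z\mid P\}\to\{z'\mid Q\}$ is small and $\lambda=[\{z,x\mid L\}]:\{z\mid P\}\to V$ is any arrow, then $$\{z',x\mid Q(z')\wedge\forall t\,(t\in x\leftrightarrow\exists z\,\exists s\,(F(z,z')\wedge L(z,s)\wedge t\in s))\}$$ represents an arrow $\{z'\mid Q\}\to V$, and this arrow is $\sup_j(\lambda)$. -/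

import Mathlib

open CategoryTheory CategoryTheory.Limits FirstOrder FirstOrder.Language
open Sum (inl inr)

attribute [-instance] catToReflQuiver

namespace AST

/-! ### The language and the axioms of ZF -/

/-- The only non-logical symbol is a binary relation symbol. -/
inductive SetRel : ℕ → Type
  | mem : SetRel 2

/-- The first-order language of set theory. -/
def LSet : FirstOrder.Language.{0, 0} := ⟨fun _ => Empty, SetRel⟩

/-- The membership symbol. -/
def memRel : LSet.Relations 2 := SetRel.mem

/-- The atomic formula `s ∈ t` (variables are either free, `inl _`, or bound, `inr _`). -/
def memF {α : Type} {n : ℕ} (s t : α ⊕ Fin n) : LSet.BoundedFormula α n :=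
  memRel.boundedFormula₂ (Term.var s) (Term.var t)

/-- The atomic formula `s = t`. -/
def eqF {α : Type} {n : ℕ} (s t : α ⊕ Fin n) : LSet.BoundedFormula α n :=
  Term.bdEqual (Term.var s) (Term.var t)

/-- `inst φ g` is `φ` with each free variable `i` replaced by the variable `g i`. -/
def inst {β α : Type} {n : ℕ} (φ : LSet.Formula β) (g : β → α ⊕ Fin n) :
    LSet.BoundedFormula α n :=
  BoundedFormula.relabel g φ

/-- The formula `x₀ = ∅`. -/
def isEmptyF : LSet.Formula (Fin 1) := ∀' ∼(memF (inr 0) (inl 0))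

/-- The formula `x₀ ⊆ x₁`. -/
def subsetF : LSet.Formula (Fin 2) := ∀' (memF (inr 0) (inl 0) ⟹ memF (inr 0) (inl 1))

/-- The formula `x₀ = {x₁}`. -/
def isSingletonF : LSet.Formula (Fin 2) := ∀' (memF (inr 0) (inl 0) ⇔ eqF (inr 0) (inl 1))

/-- The formula `x₀ = {x₁, x₂}`. -/
def isUPairF : LSet.Formula (Fin 3) :=
  ∀' (memF (inr 0) (inl 0) ⇔ (eqF (inr 0) (inl 1) ⊔ eqF (inr 0) (inl 2)))

/-- The formula `x₀ = ⟨x₁, x₂⟩ = {{x₁}, {x₁, x₂}}`. -/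
def isPairF : LSet.Formula (Fin 3) :=
  ∀' (memF (inr 0) (inl 0) ⇔
    (inst isSingletonF ![inr 0, inl 1] ⊔ inst isUPairF ![inr 0, inl 1, inl 2]))

/-- The formula `s = ⟨t, u⟩`. -/
def pairF {α : Type} {n : ℕ} (s t u : α ⊕ Fin n) : LSet.BoundedFormula α n :=
  inst isPairF ![s, t, u]

/-- The formula `x₀ = x₁ ∪ {x₁}`. -/
def isSuccF : LSet.Formula (Fin 2) :=
  ∀' (memF (inr 0) (inl 0) ⇔ (memF (inr 0) (inl 1) ⊔ eqF (inr 0) (inl 1)))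

/-- Universal closure of a formula whose free variables are parameters `p₁, …, pₖ`. -/
noncomputable def univClosure {k : ℕ} (φ : LSet.Formula (Fin k)) : LSet.Sentence :=
  Formula.iAlls (Fin k) (φ.relabel inr)

/-- `∀ x y, (∀ t, t ∈ x ↔ t ∈ y) → x = y`. -/
def axExtensionality : LSet.Sentence :=
  ∀' ∀' ((∀' (memF (inr 2) (inr 0) ⇔ memF (inr 2) (inr 1))) ⟹ eqF (inr 0) (inr 1))

/-- `∀ p, ∀ x, ∃ y, ∀ t, t ∈ y ↔ (t ∈ x ∧ P(p, t))`. -/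
noncomputable def axSeparation {k : ℕ} (P : LSet.Formula (Fin k ⊕ Fin 1)) : LSet.Sentence :=
  univClosure (∀' ∃' ∀' (memF (inr 2) (inr 1) ⇔
    (memF (inr 2) (inr 0) ⊓ inst P (Sum.elim inl ![inr 2]))))

/-- `∀ x y, ∃ z, ∀ t, t ∈ z ↔ (t = x ∨ t = y)`. -/
def axPairing : LSet.Sentence :=
  ∀' ∀' ∃' ∀' (memF (inr 3) (inr 2) ⇔ (eqF (inr 3) (inr 0) ⊔ eqF (inr 3) (inr 1)))

/-- `∀ x, ∃ z, ∀ t, t ∈ z ↔ ∃ y, t ∈ y ∧ y ∈ x`. -/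
def axUnion : LSet.Sentence :=
  ∀' ∃' ∀' (memF (inr 2) (inr 1) ⇔ ∃' (memF (inr 2) (inr 3) ⊓ memF (inr 3) (inr 0)))

/-- `∀ y, ∃ z, ∀ x, x ∈ z ↔ x ⊆ y`. -/
def axPower : LSet.Sentence :=
  ∀' ∃' ∀' (memF (inr 2) (inr 1) ⇔ inst subsetF ![inr 2, inr 0])

/-- `∀ p, ∀ z, (∀ x ∈ z, ∃! y, F(p, x, y)) → ∃ z', ∀ x ∈ z, ∃ y ∈ z', F(p, x, y)`. -/
noncomputable def axReplacement {k : ℕ} (F : LSet.Formula (Fin k ⊕ Fin 2)) : LSet.Sentence :=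
  univClosure (∀' ((∀' (memF (inr 1) (inr 0) ⟹
      ∃' (inst F (Sum.elim inl ![inr 1, inr 2]) ⊓
        ∀' (inst F (Sum.elim inl ![inr 1, inr 3]) ⟹ eqF (inr 3) (inr 2))))) ⟹
    ∃' ∀' (memF (inr 2) (inr 0) ⟹
      ∃' (memF (inr 3) (inr 1) ⊓ inst F (Sum.elim inl ![inr 2, inr 3])))))

/-- `∃ x, ∅ ∈ x ∧ ∀ t, t ∈ x → t ∪ {t} ∈ x`. -/
def axInfinity : LSet.Sentence :=
  ∃' (∃' (inst isEmptyF ![inr 1] ⊓ memF (inr 1) (inr 0)) ⊓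
    ∀' (memF (inr 1) (inr 0) ⟹ ∃' (inst isSuccF ![inr 2, inr 1] ⊓ memF (inr 2) (inr 0))))

/-- `∀ x, x ≠ ∅ → ∃ z, z ∈ x ∧ ∀ t, t ∈ x → t ∉ z`. -/
def axFoundation : LSet.Sentence :=
  ∀' (∼(inst isEmptyF ![inr 0]) ⟹
    ∃' (memF (inr 1) (inr 0) ⊓ ∀' (memF (inr 2) (inr 0) ⟹ ∼(memF (inr 2) (inr 1)))))

/-- The axioms of Zermelo–Fraenkel set theory. Entailment `⊢_ZF` is Mathlib's first-order
consequence relation `ZF ⊨ᵇ _` (also `_ ⟹[ZF] _`, `_ ⇔[ZF] _`), which by the completeness theorem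
for first-order logic is derivability from the axioms. -/
inductive IsZFAxiom : LSet.Sentence → Prop
  | extensionality : IsZFAxiom axExtensionality
  | separation {k : ℕ} (P : LSet.Formula (Fin k ⊕ Fin 1)) : IsZFAxiom (axSeparation P)
  | pairing : IsZFAxiom axPairing
  | union : IsZFAxiom axUnion
  | power : IsZFAxiom axPower
  | replacement {k : ℕ} (F : LSet.Formula (Fin k ⊕ Fin 2)) : IsZFAxiom (axReplacement F)
  | infinity : IsZFAxiom axInfinity
  | foundation : IsZFAxiom axFoundation

/-- Zermelo–Fraenkel set theory. -/
def ZF : LSet.Theory := {φ | IsZFAxiom φ}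

/-! ### Satisfaction of formulas in models of ZF -/

/-- A model of ZF. -/
abbrev ZFModel := Theory.ModelType.{0, 0, 0} ZF

/-- The membership relation of a model. -/
def E {M : ZFModel} (a b : M) : Prop :=
  Structure.RelMap memRel ![a, b]

section Realize

variable {M : ZFModel} {α β : Type} {n : ℕ} {v : α → M} {xs : Fin n → M}

@[simp] theorem realize_memF (s t : α ⊕ Fin n) :
    (memF s t).Realize v xs ↔ E (Sum.elim v xs s) (Sum.elim v xs t) := by
  unfold memF E
  rw [BoundedFormula.realize_rel₂]; rfl

@[simp] theorem realize_eqF (s t : α ⊕ Fin n) :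
    (eqF s t).Realize v xs ↔ Sum.elim v xs s = Sum.elim v xs t := Iff.rfl

@[simp] theorem realize_inst (φ : LSet.Formula β) (g : β → α ⊕ Fin n) :
    (inst φ g).Realize v xs ↔ φ.Realize (Sum.elim v xs ∘ g) := by
  unfold inst
  refine (BoundedFormula.realize_relabel (n := 0)).trans ?_
  unfold Formula.Realize
  rw [Subsingleton.elim (xs ∘ Fin.natAdd n : Fin 0 → M) default]
  rfl

theorem imp_iff {φ ψ : LSet.Formula α} :
    (φ ⟹[ZF] ψ) ↔ ∀ (M : ZFModel) (v : α → M), φ.Realize v → ψ.Realize v := by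
  unfold Theory.Imp
  rw [Theory.models_formula_iff]; rfl

theorem iff_iff {φ ψ : LSet.Formula α} :
    (φ ⇔[ZF] ψ) ↔ ∀ (M : ZFModel) (v : α → M), φ.Realize v ↔ ψ.Realize v := by
  unfold Theory.Iff
  rw [Theory.models_formula_iff]
  refine forall_congr' fun M => forall_congr' fun v => ?_
  exact BoundedFormula.realize_iff

end Realize

/-! ### The syntactic category of ZF -/

/-- A formula in context `{x₁, …, xₙ | P}`. -/
structure FormulaInContext where
  arity : ℕ
  formula : LSet.Formula (Fin arity)

/-- Representatives of arrows `{x | P} ⟶ {y | Q}`: formulas `F(x, y)` that ZF proves to be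
functional relations from `P` to `Q`. -/
structure FunctionalFormula (X Y : FormulaInContext) where
  formula : LSet.Formula (Fin X.arity ⊕ Fin Y.arity)
  entails : formula ⟹[ZF] X.formula.relabel inl ⊓ Y.formula.relabel inr
  unique : formula.relabel (Sum.map id inl) ⊓ formula.relabel (Sum.map id inr) ⟹[ZF]
    (Formula.iInf fun i : Fin Y.arity =>
      Term.equal (Term.var (inr (inl i))) (Term.var (inr (inr i))) :
      LSet.Formula (Fin X.arity ⊕ (Fin Y.arity ⊕ Fin Y.arity)))
  total : X.formula ⟹[ZF] Formula.iExs (Fin Y.arity) formula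

namespace FunctionalFormula

variable {X Y Z : FormulaInContext}

/-- The relation defined by a functional formula in a model. -/
def Rel (F : FunctionalFormula X Y) (M : ZFModel) (a : Fin X.arity → M) (b : Fin Y.arity → M) :
    Prop :=
  F.formula.Realize (Sum.elim a b)

theorem unique_iff {n m : ℕ} {φ : LSet.Formula (Fin n ⊕ Fin m)} :
    (φ.relabel (Sum.map id inl) ⊓ φ.relabel (Sum.map id inr) ⟹[ZF]
    (Formula.iInf fun i : Fin m =>
      Term.equal (Term.var (inr (inl i))) (Term.var (inr (inr i))) :
      LSet.Formula (Fin n ⊕ (Fin m ⊕ Fin m)))) ↔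
    ∀ (M : ZFModel) (a : Fin n → M) (b b' : Fin m → M),
      φ.Realize (Sum.elim a b) → φ.Realize (Sum.elim a b') → b = b' := by
  rw [imp_iff]
  refine forall_congr' fun M => ?_
  simp only [Formula.realize_inf, Formula.realize_relabel, Formula.realize_iInf,
    Formula.realize_equal, Term.realize_var]
  constructor
  · intro h a b b' h1 h2
    funext i
    refine h (Sum.elim a (Sum.elim b b')) ⟨?_, ?_⟩ i
    · convert h1 using 1; ext (i | i) <;> rfl
    · convert h2 using 1; ext (i | i) <;> rfl
  · rintro h v ⟨h1, h2⟩ i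
    refine congrFun (h (v ∘ inl) (v ∘ inr ∘ inl) (v ∘ inr ∘ inr) ?_ ?_) i
    · convert h1 using 1; ext (i | i) <;> rfl
    · convert h2 using 1; ext (i | i) <;> rfl

theorem rel_dom (F : FunctionalFormula X Y) {M : ZFModel} {a b} (h : F.Rel M a b) :
    X.formula.Realize a ∧ Y.formula.Realize b := by
  have := imp_iff.1 F.entails M _ h
  simpa only [Formula.realize_inf, Formula.realize_relabel, Sum.elim_comp_inl,
    Sum.elim_comp_inr] using this

theorem rel_unique (F : FunctionalFormula X Y) {M : ZFModel} {a b b'} (h : F.Rel M a b)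
    (h' : F.Rel M a b') : b = b' :=
  unique_iff.1 F.unique M a b b' h h'

theorem rel_total (F : FunctionalFormula X Y) {M : ZFModel} {a} (h : X.formula.Realize a) :
    ∃ b, F.Rel M a b := by
  have := imp_iff.1 F.total M _ h
  simpa only [Formula.realize_iExs, Rel] using this

/-- Functionality of a formula may be checked in all models. -/
def ofModels (φ : LSet.Formula (Fin X.arity ⊕ Fin Y.arity))
    (h1 : ∀ (M : ZFModel) (a : Fin X.arity → M) (b : Fin Y.arity → M),
      φ.Realize (Sum.elim a b) → X.formula.Realize a ∧ Y.formula.Realize b)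
    (h2 : ∀ (M : ZFModel) (a : Fin X.arity → M) (b b' : Fin Y.arity → M),
      φ.Realize (Sum.elim a b) → φ.Realize (Sum.elim a b') → b = b')
    (h3 : ∀ (M : ZFModel) (a : Fin X.arity → M), X.formula.Realize a →
      ∃ b : Fin Y.arity → M, φ.Realize (Sum.elim a b)) : FunctionalFormula X Y where
  formula := φ
  entails := imp_iff.2 fun M v hv => by
    have := h1 M (v ∘ inl) (v ∘ inr) (by rwa [Sum.elim_comp_inl_inr])
    simpa only [Formula.realize_inf, Formula.realize_relabel] using this
  unique := unique_iff.2 h2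
  total := imp_iff.2 fun M v hv => by
    simpa only [Formula.realize_iExs] using h3 M v hv

/-- Provable equivalence of representatives. -/
instance setoid (X Y : FormulaInContext) : Setoid (FunctionalFormula X Y) where
  r F G := F.formula ⇔[ZF] G.formula
  iseqv := ⟨fun _ => Theory.Iff.refl _, fun h => h.symm, fun h h' => h.trans h'⟩

theorem equiv_iff {F G : FunctionalFormula X Y} :
    F ≈ G ↔ ∀ (M : ZFModel) a b, F.Rel M a b ↔ G.Rel M a b := by
  refine (iff_iff (φ := F.formula) (ψ := G.formula)).trans ?_
  refine forall_congr' fun M => ⟨fun h a b => h _, fun h v => ?_⟩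
  have := h (v ∘ inl) (v ∘ inr)
  simpa only [Rel, Sum.elim_comp_inl_inr] using this

/-- The formula `{x, x' | P(x) ∧ x = x'}`. -/
noncomputable def identity (X : FormulaInContext) : FunctionalFormula X X :=
  ofModels (X.formula.relabel inl ⊓ Formula.iInf fun i : Fin X.arity =>
      Term.equal (Term.var (inl i)) (Term.var (inr i)))
    (fun M a b h => by
      simp only [Formula.realize_inf, Formula.realize_relabel, Formula.realize_iInf,
        Formula.realize_equal, Term.realize_var, Sum.elim_inl, Sum.elim_inr,
        Sum.elim_comp_inl] at h
      obtain rfl : a = b := funext h.2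
      exact ⟨h.1, h.1⟩)
    (fun M a b b' h h' => by
      simp only [Formula.realize_inf, Formula.realize_relabel, Formula.realize_iInf,
        Formula.realize_equal, Term.realize_var, Sum.elim_inl, Sum.elim_inr,
        Sum.elim_comp_inl] at h h'
      exact funext fun i => (h.2 i).symm.trans (h'.2 i))
    (fun M a h => ⟨a, by
      simpa only [Formula.realize_inf, Formula.realize_relabel, Formula.realize_iInf,
        Formula.realize_equal, Term.realize_var, Sum.elim_inl, Sum.elim_inr,
        Sum.elim_comp_inl, implies_true, and_true] using h⟩)

theorem identity_rel {M : ZFModel} {a b : Fin X.arity → M} :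
    (identity X).Rel M a b ↔ X.formula.Realize a ∧ a = b := by
  simp only [identity, ofModels, Rel, Formula.realize_inf, Formula.realize_relabel,
    Formula.realize_iInf, Formula.realize_equal, Term.realize_var, Sum.elim_inl, Sum.elim_inr,
    Sum.elim_comp_inl, funext_iff]

/-- The formula `{x, z | ∃ y, F(x, y) ∧ G(y, z)}`. -/
noncomputable def compFormula {n m k : ℕ} (F : LSet.Formula (Fin n ⊕ Fin m))
    (G : LSet.Formula (Fin m ⊕ Fin k)) : LSet.Formula (Fin n ⊕ Fin k) :=
  Formula.iExs (Fin m)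
    (F.relabel (Sum.elim (fun i => inl (inl i)) inr) ⊓
      G.relabel (Sum.elim inr (fun i => inl (inr i))))

theorem realize_compFormula {n m k : ℕ} {F : LSet.Formula (Fin n ⊕ Fin m)}
    {G : LSet.Formula (Fin m ⊕ Fin k)} {M : ZFModel} {a : Fin n → M} {c : Fin k → M} :
    (compFormula F G).Realize (Sum.elim a c) ↔
      ∃ b : Fin m → M, F.Realize (Sum.elim a b) ∧ G.Realize (Sum.elim b c) := by
  simp only [compFormula, Formula.realize_iExs, Formula.realize_inf, Formula.realize_relabel]
  refine exists_congr fun b => and_congr ?_ ?_ <;>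
  · refine iff_of_eq (congrArg _ ?_)
    ext (i | i) <;> rfl

/-- Composition of representatives. -/
noncomputable def comp (F : FunctionalFormula X Y) (G : FunctionalFormula Y Z) :
    FunctionalFormula X Z :=
  ofModels (compFormula F.formula G.formula)
    (fun M a c h => by
      obtain ⟨b, h1, h2⟩ := realize_compFormula.1 h
      exact ⟨(F.rel_dom h1).1, (G.rel_dom h2).2⟩)
    (fun M a c c' h h' => by
      obtain ⟨b, h1, h2⟩ := realize_compFormula.1 h
      obtain ⟨b', h1', h2'⟩ := realize_compFormula.1 h'
      obtain rfl := F.rel_unique h1 h1'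
      exact G.rel_unique h2 h2')
    (fun M a h => by
      obtain ⟨b, hb⟩ := F.rel_total h
      obtain ⟨c, hc⟩ := G.rel_total (F.rel_dom hb).2
      exact ⟨c, realize_compFormula.2 ⟨b, hb, hc⟩⟩)

theorem comp_rel {F : FunctionalFormula X Y} {G : FunctionalFormula Y Z} {M : ZFModel} {a c} :
    (F.comp G).Rel M a c ↔ ∃ b, F.Rel M a b ∧ G.Rel M b c :=
  realize_compFormula

end FunctionalFormula

/-- The syntactic category of ZF: arrows are functional formulas up to provable equivalence. -/
noncomputable instance : Category FormulaInContext where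
  Hom X Y := Quotient (FunctionalFormula.setoid X Y)
  id X := Quotient.mk _ (FunctionalFormula.identity X)
  comp f g := Quotient.map₂ FunctionalFormula.comp (fun F F' h G G' h' => by
    rw [FunctionalFormula.equiv_iff] at *
    intro M a b
    simp only [FunctionalFormula.comp_rel, h, h']) f g
  id_comp f := by
    induction f using Quotient.inductionOn with | _ F
    refine Quotient.sound (FunctionalFormula.equiv_iff.2 fun M a b => ?_)
    simp only [FunctionalFormula.comp_rel, FunctionalFormula.identity_rel]
    exact ⟨fun ⟨c, ⟨_, h⟩, h'⟩ => h ▸ h', fun h => ⟨a, ⟨(F.rel_dom h).1, rfl⟩, h⟩⟩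
  comp_id f := by
    induction f using Quotient.inductionOn with | _ F
    refine Quotient.sound (FunctionalFormula.equiv_iff.2 fun M a b => ?_)
    simp only [FunctionalFormula.comp_rel, FunctionalFormula.identity_rel]
    exact ⟨fun ⟨c, h', ⟨_, h⟩⟩ => h ▸ h', fun h => ⟨b, h, ⟨(F.rel_dom h).2, rfl⟩⟩⟩
  assoc f g h := by
    induction f using Quotient.inductionOn with | _ F
    induction g using Quotient.inductionOn with | _ G
    induction h using Quotient.inductionOn with | _ H
    refine Quotient.sound (FunctionalFormula.equiv_iff.2 fun M a b => ?_)
    simp only [FunctionalFormula.comp_rel]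
    constructor
    · rintro ⟨c, ⟨d, h1, h2⟩, h3⟩; exact ⟨d, h1, c, h2, h3⟩
    · rintro ⟨d, h1, c, h2, h3⟩; exact ⟨c, ⟨d, h1, h2⟩, h3⟩

/-! ### The category of definable classes -/

/-- A definable class `{x | P}`: a formula in context whose context has length one. -/
structure DefClass where
  formula : LSet.Formula (Fin 1)

/-- A definable class as a formula in context. -/
def DefClass.toContext (X : DefClass) : FormulaInContext := ⟨1, X.formula⟩

/-- The category of definable classes, the full subcategory of the syntactic category on the
formulas in context with exactly one variable. -/
abbrev DCL := InducedCategory FormulaInContext DefClass.toContext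

/-- The formula `P(s)`. -/
def inst₁ {α : Type} {n : ℕ} (P : LSet.Formula (Fin 1)) (s : α ⊕ Fin n) :
    LSet.BoundedFormula α n := inst P (fun _ => s)

/-- The formula `F(s, t)`. -/
def inst₂ {α : Type} {n : ℕ} (F : LSet.Formula (Fin 1 ⊕ Fin 1)) (s t : α ⊕ Fin n) :
    LSet.BoundedFormula α n := inst F (Sum.elim (fun _ => s) (fun _ => t))

/-- The first of the two free variables of a formula `F(x, y)`. -/
abbrev vx {n : ℕ} : (Fin 1 ⊕ Fin 1) ⊕ Fin n := inl (inl 0)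

/-- The second of the two free variables of a formula `F(x, y)`. -/
abbrev vy {n : ℕ} : (Fin 1 ⊕ Fin 1) ⊕ Fin n := inl (inr 0)

/-- Functional formulas between definable classes. -/
abbrev ClassFun (X Y : DCL) := FunctionalFormula (DefClass.toContext X) (DefClass.toContext Y)

/-- The underlying formula of a functional formula between definable classes. -/
def ClassFun.toFormula {X Y : DCL} (F : ClassFun X Y) : LSet.Formula (Fin 1 ⊕ Fin 1) :=
  FunctionalFormula.formula F

/-- The arrow `[{x, y | F}]` of definable classes. -/
def arrow {X Y : DCL} (F : ClassFun X Y) : X ⟶ Y := ⟨Quotient.mk _ F⟩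

/-! ### Semantics of definable classes -/

/-- The extension of a unary formula in a model. -/
def Sat (P : LSet.Formula (Fin 1)) {M : ZFModel} (a : M) : Prop := P.Realize (fun _ => a)

/-- The extension of a binary formula in a model. -/
def Sat₂ (F : LSet.Formula (Fin 1 ⊕ Fin 1)) {M : ZFModel} (a b : M) : Prop :=
  F.Realize (Sum.elim (fun _ => a) (fun _ => b))

/-- The extension of a definable class in a model. -/
def Mem (X : DCL) {M : ZFModel} (a : M) : Prop := Sat (DefClass.formula X) a

/-- A formula representing an arrow of definable classes. -/
noncomputable def rep {X Y : DCL} (f : X ⟶ Y) : LSet.Formula (Fin 1 ⊕ Fin 1) :=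
  ClassFun.toFormula (Quotient.out f.hom)

/-- The relation which an arrow of definable classes defines in a model. -/
noncomputable def Holds {X Y : DCL} (f : X ⟶ Y) {M : ZFModel} (a b : M) : Prop :=
  Sat₂ (rep f) a b

section

variable {M : ZFModel} {α : Type} {n : ℕ} {v : α → M} {xs : Fin n → M} {X Y Z : DCL}

@[simp] theorem realize_inst₁ (P : LSet.Formula (Fin 1)) (s : α ⊕ Fin n) :
    (inst₁ P s).Realize v xs ↔ Sat P (Sum.elim v xs s) := by
  simp only [inst₁, realize_inst, Sat]; rfl

@[simp] theorem realize_inst₂ (F : LSet.Formula (Fin 1 ⊕ Fin 1)) (s t : α ⊕ Fin n) :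
    (inst₂ F s t).Realize v xs ↔ Sat₂ F (Sum.elim v xs s) (Sum.elim v xs t) := by
  simp only [inst₂, realize_inst, Sat₂]
  refine iff_of_eq (congrArg _ ?_)
  ext (i | i) <;> rfl

theorem sat_iff {P : LSet.Formula (Fin 1)} {a : M} :
    Sat P a ↔ BoundedFormula.Realize P (fun _ => a) default := Iff.rfl

theorem sat₂_iff {F : LSet.Formula (Fin 1 ⊕ Fin 1)} {a b : M} :
    Sat₂ F a b ↔ BoundedFormula.Realize F (Sum.elim (fun _ => a) (fun _ => b)) default := Iff.rfl

theorem realize_sat {P : LSet.Formula (Fin 1)} {a : Fin 1 → M} : P.Realize a ↔ Sat P (a 0) := by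
  unfold Sat
  refine iff_of_eq (congrArg _ ?_)
  ext i; rw [Subsingleton.elim i 0]

theorem realize_sat₂ {F : LSet.Formula (Fin 1 ⊕ Fin 1)} {a b : Fin 1 → M} :
    F.Realize (Sum.elim a b) ↔ Sat₂ F (a 0) (b 0) := by
  unfold Sat₂
  refine iff_of_eq (congrArg _ ?_)
  ext (i | i) <;> simp [Subsingleton.elim i 0]

/-- Functionality of a formula between definable classes may be checked in all models. -/
def ClassFun.ofModels (X Y : DCL) (φ : LSet.Formula (Fin 1 ⊕ Fin 1))
    (h1 : ∀ (M : ZFModel) (a b : M), Sat₂ φ a b → Mem X a ∧ Mem Y b)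
    (h2 : ∀ (M : ZFModel) (a b b' : M), Sat₂ φ a b → Sat₂ φ a b' → b = b')
    (h3 : ∀ (M : ZFModel) (a : M), Mem X a → ∃ b : M, Sat₂ φ a b) : ClassFun X Y :=
  FunctionalFormula.ofModels (X := DefClass.toContext X) (Y := DefClass.toContext Y) φ
    (fun M a b h => by
      have := h1 M _ _ (realize_sat₂.1 h)
      exact ⟨realize_sat.2 this.1, realize_sat.2 this.2⟩)
    (fun M a b b' h h' => by
      have := h2 M _ _ _ (realize_sat₂.1 h) (realize_sat₂.1 h')
      funext (i : Fin 1); rw [Subsingleton.elim i 0]; exact this)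
    (fun M a h => by
      obtain ⟨b, hb⟩ := h3 M _ (realize_sat.1 h)
      exact ⟨fun _ => b, realize_sat₂.2 hb⟩)

theorem ClassFun.equiv_iff {F G : ClassFun X Y} :
    F ≈ G ↔ ∀ (M : ZFModel) (a b : M), Sat₂ F.toFormula a b ↔ Sat₂ G.toFormula a b := by
  rw [FunctionalFormula.equiv_iff]
  exact ⟨fun h M a b => h M _ _, fun h M a b =>
    realize_sat₂.trans ((h M _ _).trans realize_sat₂.symm)⟩

theorem holds_arrow (F : ClassFun X Y) (a b : M) : Holds (arrow F) a b ↔ Sat₂ F.toFormula a b :=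
  ClassFun.equiv_iff.1 (Quotient.mk_out F) M a b

theorem arrow_out (f : X ⟶ Y) : arrow (Quotient.out f.hom) = f :=
  InducedCategory.Hom.ext (Quotient.out_eq _)

theorem hom_ext {f g : X ⟶ Y} (h : ∀ (M : ZFModel) (a b : M), Holds f a b ↔ Holds g a b) :
    f = g := by
  rw [← arrow_out f, ← arrow_out g]
  exact InducedCategory.Hom.ext (Quotient.sound (ClassFun.equiv_iff.2 h))

theorem arrow_eq_iff {F G : ClassFun X Y} : arrow F = arrow G ↔
    ∀ (M : ZFModel) (a b : M), Sat₂ F.toFormula a b ↔ Sat₂ G.toFormula a b :=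
  ⟨fun h M a b => by rw [← holds_arrow, h, holds_arrow],
    fun h => hom_ext fun M a b => by rw [holds_arrow, holds_arrow, h]⟩

theorem Holds.dom {f : X ⟶ Y} {a b : M} (h : Holds f a b) : Mem X a ∧ Mem Y b :=
  FunctionalFormula.rel_dom _ h

theorem Holds.unique {f : X ⟶ Y} {a b b' : M} (h : Holds f a b) (h' : Holds f a b') : b = b' :=
  congrFun (FunctionalFormula.rel_unique _ h h') (0 : Fin 1)

theorem Holds.exists (f : X ⟶ Y) {a : M} (h : Mem X a) : ∃ b, Holds f a b := by
  obtain ⟨b, hb⟩ := FunctionalFormula.rel_total (Quotient.out f.hom) h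
  exact ⟨b (0 : Fin 1), realize_sat₂.1 hb⟩

@[simp] theorem holds_id {a b : M} : Holds (𝟙 X) a b ↔ Mem X a ∧ a = b := by
  have : 𝟙 X = arrow (FunctionalFormula.identity _) := rfl
  rw [this, holds_arrow]
  refine (FunctionalFormula.identity_rel (a := fun _ => a) (b := fun _ => b)).trans ?_
  exact and_congr Iff.rfl ⟨fun h => congrFun h (0 : Fin 1), fun h => h ▸ rfl⟩

@[simp] theorem holds_comp {f : X ⟶ Y} {g : Y ⟶ Z} {a c : M} :
    Holds (f ≫ g) a c ↔ ∃ b, Holds f a b ∧ Holds g b c := by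
  have : f ≫ g = arrow (FunctionalFormula.comp (Quotient.out f.hom) (Quotient.out g.hom)) := by
    conv_lhs => rw [← arrow_out f, ← arrow_out g]
    rfl
  rw [this, holds_arrow]
  refine (FunctionalFormula.comp_rel (a := fun _ => a) (c := fun _ => c)).trans ?_
  constructor
  · rintro ⟨b, h1, h2⟩; exact ⟨b (0 : Fin 1), realize_sat₂.1 h1, realize_sat₂.1 h2⟩
  · rintro ⟨b, h1, h2⟩; exact ⟨fun _ => b, realize_sat₂.2 h1, realize_sat₂.2 h2⟩

end

/-! ### Elementary facts about models of ZF -/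

section

variable {M : ZFModel}

theorem model_axiom (M : ZFModel) {φ : LSet.Sentence} (h : IsZFAxiom φ) : M ⊨ φ :=
  Theory.realize_sentence_of_mem ZF h

theorem model_ext {a b : M} (h : ∀ t : M, E t a ↔ E t b) : a = b := by
  have := model_axiom M .extensionality
  simp [axExtensionality, Sentence.Realize, Formula.Realize, Fin.snoc] at this
  exact this a b h

theorem model_pairing (a b : M) : ∃ c : M, ∀ t : M, E t c ↔ t = a ∨ t = b := by
  have := model_axiom M .pairing
  simp [axPairing, Sentence.Realize, Formula.Realize, Fin.snoc] at this
  exact this a b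

theorem model_empty (M : ZFModel) : ∃ c : M, ∀ t : M, ¬ E t c := by
  have := model_axiom M .infinity
  simp [axInfinity, Sentence.Realize, Formula.Realize, Fin.snoc, isEmptyF] at this
  obtain ⟨x, ⟨c, h, -⟩, -⟩ := this
  exact ⟨c, h⟩

/-- `z = ⟨x, y⟩` in a model. -/
def IsPair (z x y : M) : Prop := isPairF.Realize ![z, x, y]

theorem comp_three {A B : Type} (g : A → B) (a b c : A) : g ∘ ![a, b, c] = ![g a, g b, g c] := by
  ext i; fin_cases i <;> rfl

theorem comp_two {A B : Type} (g : A → B) (a b : A) : g ∘ ![a, b] = ![g a, g b] := by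
  ext i; fin_cases i <;> rfl

@[simp] theorem realize_pairF {α : Type} {n : ℕ} {v : α → M} {xs : Fin n → M}
    (s t u : α ⊕ Fin n) : (pairF s t u).Realize v xs ↔
      IsPair (Sum.elim v xs s) (Sum.elim v xs t) (Sum.elim v xs u) := by
  rw [pairF, realize_inst, comp_three]; rfl

theorem isPair_iff {z x y : M} : IsPair z x y ↔
    ∀ w, E w z ↔ (∀ u, E u w ↔ u = x) ∨ (∀ u, E u w ↔ u = x ∨ u = y) := by
  simp [IsPair, isPairF, isSingletonF, isUPairF, Formula.Realize, Fin.snoc]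

theorem pair_exists (x y : M) : ∃ z, IsPair z x y := by
  obtain ⟨a, ha⟩ := model_pairing x x
  obtain ⟨b, hb⟩ := model_pairing x y
  obtain ⟨z, hz⟩ := model_pairing a b
  refine ⟨z, isPair_iff.2 fun w => ?_⟩
  rw [hz]
  refine or_congr ⟨?_, fun h => model_ext fun t => ?_⟩ ⟨?_, fun h => model_ext fun t => ?_⟩
  · rintro rfl u; rw [ha, or_self]
  · rw [h, ha, or_self]
  · rintro rfl; exact hb
  · rw [h, hb]

theorem pair_unique {z z' x y : M} (h : IsPair z x y) (h' : IsPair z' x y) : z = z' :=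
  model_ext fun t => by rw [isPair_iff.1 h, isPair_iff.1 h']

theorem pair_inj {z x y x' y' : M} (h : IsPair z x y) (h' : IsPair z x' y') :
    x = x' ∧ y = y' := by
  rw [isPair_iff] at h h'
  obtain ⟨a, ha⟩ := model_pairing x x
  obtain ⟨b, hb⟩ := model_pairing x y
  obtain ⟨b', hb'⟩ := model_pairing x' y'
  have hx : x' = x := by
    rcases (h' a).1 ((h a).2 (Or.inl (by simpa using ha))) with k | k
    · simpa using (ha x').1 ((k x').2 rfl)
    · simpa using (ha x').1 ((k x').2 (Or.inl rfl))
  subst hx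
  have h1 : y = x' ∨ y = y' := by
    rcases (h' b).1 ((h b).2 (Or.inr hb)) with k | k
    · exact Or.inl ((k y).1 ((hb y).2 (Or.inr rfl)))
    · exact (k y).1 ((hb y).2 (Or.inr rfl))
  have h2 : y' = x' ∨ y' = y := by
    rcases (h b').1 ((h' b').2 (Or.inr hb')) with k | k
    · exact Or.inl ((k y').1 ((hb' y').2 (Or.inr rfl)))
    · exact (k y').1 ((hb' y').2 (Or.inr rfl))
  refine ⟨rfl, ?_⟩
  rcases h1 with h1 | h1
  · rcases h2 with h2 | h2
    · rw [h1, h2]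
    · exact h2.symm
  · exact h1

end

/-! ### Finite limits of definable classes -/

namespace DCL

variable {X Y Z : DCL}

/-- Arrows from functional formulas, functionality being checked in all models. -/
def mkHom (X Y : DCL) (φ : LSet.Formula (Fin 1 ⊕ Fin 1))
    (h1 : ∀ (M : ZFModel) (a b : M), Sat₂ φ a b → Mem X a ∧ Mem Y b)
    (h2 : ∀ (M : ZFModel) (a b b' : M), Sat₂ φ a b → Sat₂ φ a b' → b = b')
    (h3 : ∀ (M : ZFModel) (a : M), Mem X a → ∃ b : M, Sat₂ φ a b) : X ⟶ Y :=
  arrow (ClassFun.ofModels X Y φ h1 h2 h3)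

@[simp] theorem holds_mkHom {φ : LSet.Formula (Fin 1 ⊕ Fin 1)} {h1 h2 h3} {M : ZFModel}
    {a b : M} : Holds (mkHom X Y φ h1 h2 h3) a b ↔ Sat₂ φ a b :=
  holds_arrow _ _ _

/-- The class `{x | x = ∅}`. -/
def one : DCL := DefClass.mk isEmptyF

theorem mem_one {M : ZFModel} {a : M} : Mem one a ↔ ∀ t : M, ¬ E t a := by
  simp [Mem, Sat, one, isEmptyF, Formula.Realize, Fin.snoc]

theorem mem_one_unique {M : ZFModel} {a b : M} (ha : Mem one a) (hb : Mem one b) : a = b :=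
  model_ext fun t => iff_of_false (mem_one.1 ha t) (mem_one.1 hb t)

/-- The formula `{x, y | P(x) ∧ y = ∅}`. -/
def toOne (X : DCL) : X ⟶ one :=
  mkHom X one (inst₁ (DefClass.formula X) vx ⊓ inst₁ isEmptyF vy)
    (fun M a b h => by
      rw [sat₂_iff] at h
      simp at h
      exact h)
    (fun M a b b' h h' => by
      rw [sat₂_iff] at h h'
      simp at h h'
      exact mem_one_unique h.2 h'.2)
    (fun M a h => by
      obtain ⟨c, hc⟩ := model_empty M
      refine ⟨c, ?_⟩
      rw [sat₂_iff]
      simp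
      exact ⟨h, mem_one.2 hc⟩)

instance : HasTerminal DCL :=
  (IsTerminal.ofUniqueHom toOne fun X f => hom_ext fun M a b => by
    constructor
    · intro h
      obtain ⟨c, hc⟩ := Holds.exists (toOne X) h.dom.1
      rwa [mem_one_unique h.dom.2 hc.dom.2]
    · intro h
      obtain ⟨c, hc⟩ := Holds.exists f h.dom.1
      rwa [mem_one_unique h.dom.2 hc.dom.2]).hasTerminal

/-- The class `{z | ∃ x y, z = ⟨x, y⟩ ∧ P(x) ∧ Q(y)}`. -/
def pairs (X Y : DCL) : DCL := DefClass.mk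
  (∃' ∃' (pairF (inl 0) (inr 0) (inr 1) ⊓
    (inst₁ (DefClass.formula X) (inr 0) ⊓ inst₁ (DefClass.formula Y) (inr 1))))

theorem mem_pairs {M : ZFModel} {z : M} :
    Mem (pairs X Y) z ↔ ∃ x y, IsPair z x y ∧ Mem X x ∧ Mem Y y := by
  rw [Mem, pairs, sat_iff]
  simp [Fin.snoc, Mem]

/-- The formula `{z, x | ∃ y, z = ⟨x, y⟩ ∧ P(x) ∧ Q(y)}`. -/
def pairsFst (X Y : DCL) : pairs X Y ⟶ X :=
  mkHom _ _ (∃' (pairF vx vy (inr 0) ⊓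
      (inst₁ (DefClass.formula X) vy ⊓ inst₁ (DefClass.formula Y) (inr 0))))
    (fun M a b h => by
      rw [sat₂_iff] at h
      simp [Fin.snoc] at h
      obtain ⟨y, h1, h2, h3⟩ := h
      exact ⟨mem_pairs.2 ⟨_, _, h1, h2, h3⟩, h2⟩)
    (fun M a b b' h h' => by
      rw [sat₂_iff] at h h'
      simp [Fin.snoc] at h h'
      obtain ⟨y, h1, -⟩ := h
      obtain ⟨y', h1', -⟩ := h'
      exact (pair_inj h1 h1').1)
    (fun M a h => by
      obtain ⟨x, y, h⟩ := mem_pairs.1 h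
      refine ⟨x, ?_⟩
      rw [sat₂_iff]
      simp [Fin.snoc]
      exact ⟨y, h⟩)

theorem holds_pairsFst {M : ZFModel} {z x : M} :
    Holds (pairsFst X Y) z x ↔ ∃ y, IsPair z x y ∧ Mem X x ∧ Mem Y y := by
  rw [pairsFst, holds_mkHom, sat₂_iff]
  simp [Fin.snoc, Mem]

/-- The formula `{z, y | ∃ x, z = ⟨x, y⟩ ∧ P(x) ∧ Q(y)}`. -/
def pairsSnd (X Y : DCL) : pairs X Y ⟶ Y :=
  mkHom _ _ (∃' (pairF vx (inr 0) vy ⊓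
      (inst₁ (DefClass.formula X) (inr 0) ⊓ inst₁ (DefClass.formula Y) vy)))
    (fun M a b h => by
      rw [sat₂_iff] at h
      simp [Fin.snoc] at h
      obtain ⟨y, h1, h2, h3⟩ := h
      exact ⟨mem_pairs.2 ⟨_, _, h1, h2, h3⟩, h3⟩)
    (fun M a b b' h h' => by
      rw [sat₂_iff] at h h'
      simp [Fin.snoc] at h h'
      obtain ⟨y, h1, -⟩ := h
      obtain ⟨y', h1', -⟩ := h'
      exact (pair_inj h1 h1').2)
    (fun M a h => by
      obtain ⟨x, y, h⟩ := mem_pairs.1 h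
      refine ⟨y, ?_⟩
      rw [sat₂_iff]
      simp [Fin.snoc]
      exact ⟨x, h⟩)

theorem holds_pairsSnd {M : ZFModel} {z y : M} :
    Holds (pairsSnd X Y) z y ↔ ∃ x, IsPair z x y ∧ Mem X x ∧ Mem Y y := by
  rw [pairsSnd, holds_mkHom, sat₂_iff]
  simp [Fin.snoc, Mem]

/-- The formula `{w, z | ∃ x y, F(w, x) ∧ G(w, y) ∧ z = ⟨x, y⟩}`. -/
noncomputable def pairsLift (f : Z ⟶ X) (g : Z ⟶ Y) : Z ⟶ pairs X Y :=
  mkHom _ _ (∃' ∃' ((inst₂ (rep f) vx (inr 0) ⊓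
      inst₂ (rep g) vx (inr 1)) ⊓ pairF vy (inr 0) (inr 1)))
    (fun M a b h => by
      rw [sat₂_iff] at h
      simp [Fin.snoc] at h
      obtain ⟨x, y, ⟨h1, h2⟩, h3⟩ := h
      have h1 : Holds f a x := h1
      have h2 : Holds g a y := h2
      exact ⟨h1.dom.1, mem_pairs.2 ⟨x, y, h3, h1.dom.2, h2.dom.2⟩⟩)
    (fun M a b b' h h' => by
      rw [sat₂_iff] at h h'
      simp [Fin.snoc] at h h'
      obtain ⟨x, y, ⟨h1, h2⟩, h3⟩ := h
      obtain ⟨x', y', ⟨h1', h2'⟩, h3'⟩ := h'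
      obtain rfl := Holds.unique (f := f) h1 h1'
      obtain rfl := Holds.unique (f := g) h2 h2'
      exact pair_unique h3 h3')
    (fun M a h => by
      obtain ⟨x, hx⟩ := Holds.exists f h
      obtain ⟨y, hy⟩ := Holds.exists g h
      obtain ⟨z, hz⟩ := pair_exists x y
      refine ⟨z, ?_⟩
      rw [sat₂_iff]
      simp [Fin.snoc]
      exact ⟨x, y, ⟨hx, hy⟩, hz⟩)

theorem holds_pairsLift {f : Z ⟶ X} {g : Z ⟶ Y} {M : ZFModel} {w z : M} :
    Holds (pairsLift f g) w z ↔ ∃ x y, (Holds f w x ∧ Holds g w y) ∧ IsPair z x y := by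
  simp only [pairsLift, holds_mkHom]
  rw [sat₂_iff]
  simp [Fin.snoc, Holds]

theorem pairsLift_fst (f : Z ⟶ X) (g : Z ⟶ Y) : pairsLift f g ≫ pairsFst X Y = f :=
  hom_ext fun M a b => by
    simp only [holds_comp, holds_pairsLift, holds_pairsFst]
    constructor
    · rintro ⟨z, ⟨x, y, ⟨h1, h2⟩, h3⟩, y', h3', -⟩
      rwa [← (pair_inj h3 h3').1]
    · intro h
      obtain ⟨y, hy⟩ := Holds.exists g h.dom.1
      obtain ⟨z, hz⟩ := pair_exists b y
      exact ⟨z, ⟨b, y, ⟨h, hy⟩, hz⟩, y, hz, h.dom.2, hy.dom.2⟩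

theorem pairsLift_snd (f : Z ⟶ X) (g : Z ⟶ Y) : pairsLift f g ≫ pairsSnd X Y = g :=
  hom_ext fun M a b => by
    simp only [holds_comp, holds_pairsLift, holds_pairsSnd]
    constructor
    · rintro ⟨z, ⟨x, y, ⟨h1, h2⟩, h3⟩, y', h3', -⟩
      rwa [← (pair_inj h3 h3').2]
    · intro h
      obtain ⟨x, hx⟩ := Holds.exists f h.dom.1
      obtain ⟨z, hz⟩ := pair_exists x b
      exact ⟨z, ⟨x, b, ⟨hx, h⟩, hz⟩, x, hz, hx.dom.2, h.dom.2⟩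

theorem pairsLift_uniq (m : Z ⟶ pairs X Y) :
    m = pairsLift (m ≫ pairsFst X Y) (m ≫ pairsSnd X Y) :=
  hom_ext fun M a b => by
    simp only [holds_pairsLift, holds_comp, holds_pairsFst, holds_pairsSnd]
    constructor
    · intro h
      obtain ⟨x, y, hp, hx, hy⟩ := mem_pairs.1 h.dom.2
      exact ⟨x, y, ⟨⟨b, h, y, hp, hx, hy⟩, ⟨b, h, x, hp, hx, hy⟩⟩, hp⟩
    · rintro ⟨x, y, ⟨⟨c, h, y', hp, -⟩, ⟨c', h', x', hp', -⟩⟩, hb⟩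
      obtain rfl := h.unique h'
      obtain ⟨rfl, rfl⟩ := pair_inj hp hp'
      rwa [pair_unique hb hp]

instance : HasBinaryProducts DCL := by
  have (X Y : DCL) : HasLimit (pair X Y) := HasLimit.mk ⟨_, BinaryFan.isLimitMk
    (fst := pairsFst X Y) (snd := pairsSnd X Y) (fun s => pairsLift s.fst s.snd)
    (fun s => pairsLift_fst s.fst s.snd) (fun s => pairsLift_snd s.fst s.snd)
    (fun s m h1 h2 => by rw [← h1, ← h2]; exact pairsLift_uniq m)⟩
  exact hasBinaryProducts_of_hasLimit_pair _

/-- The class `{x | ∃ y, F(x, y) ∧ G(x, y)}`. -/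
noncomputable def agree (f g : X ⟶ Y) : DCL := DefClass.mk
  (∃' (inst₂ (rep f) (inl 0) (inr 0) ⊓
    inst₂ (rep g) (inl 0) (inr 0)))

theorem mem_agree {f g : X ⟶ Y} {M : ZFModel} {a : M} :
    Mem (agree f g) a ↔ ∃ b, Holds f a b ∧ Holds g a b := by
  rw [Mem, agree, sat_iff]
  simp [Fin.snoc, Holds]

/-- The inclusion of a subclass, `{x, x' | P(x) ∧ x = x'}`. -/
def incl (X Y : DCL) (h : ∀ (M : ZFModel) (a : M), Mem X a → Mem Y a) : X ⟶ Y :=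
  mkHom _ _ (inst₁ (DefClass.formula X) vx ⊓ eqF vx vy)
    (fun M a b k => by
      rw [sat₂_iff] at k
      simp at k
      obtain ⟨k, rfl⟩ := k
      exact ⟨k, h M a k⟩)
    (fun M a b b' k k' => by
      rw [sat₂_iff] at k k'
      simp at k k'
      exact k.2.symm.trans k'.2)
    (fun M a k => by
      refine ⟨a, ?_⟩
      rw [sat₂_iff]
      simp
      exact k)

theorem holds_incl {h : ∀ (M : ZFModel) (a : M), Mem X a → Mem Y a} {M : ZFModel} {a b : M} :
    Holds (incl X Y h) a b ↔ Mem X a ∧ a = b := by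
  rw [incl, holds_mkHom, sat₂_iff]
  simp [Mem]

/-- An arrow whose values lie in a subclass of the codomain, corestricted to it. -/
noncomputable def corestrict (k : Z ⟶ X) (Y : DCL)
    (h : ∀ (M : ZFModel) (a b : M), Holds k a b → Mem Y b) : Z ⟶ Y :=
  mkHom _ _ (rep k)
    (fun M a b hk => ⟨(Holds.dom (f := k) hk).1, h M a b hk⟩)
    (fun _ _ _ _ hk hk' => Holds.unique (f := k) hk hk')
    (fun _ _ ha => Holds.exists k ha)

theorem holds_corestrict {k : Z ⟶ X} {h : ∀ (M : ZFModel) (a b : M), Holds k a b → Mem Y b}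
    {M : ZFModel} {a b : M} : Holds (corestrict k Y h) a b ↔ Holds k a b := by
  exact holds_arrow _ _ _

theorem agree_sub (f g : X ⟶ Y) (M : ZFModel) (a : M) (h : Mem (agree f g) a) : Mem X a := by
  obtain ⟨b, hb, -⟩ := mem_agree.1 h
  exact hb.dom.1

theorem agree_of_comp {f g : X ⟶ Y} {k : Z ⟶ X} (hk : k ≫ f = k ≫ g) (M : ZFModel) (a b : M)
    (h : Holds k a b) : Mem (agree f g) b := by
  obtain ⟨c, hc⟩ := Holds.exists f h.dom.2
  have : Holds (k ≫ g) a c := hk ▸ holds_comp.2 ⟨b, h, hc⟩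
  obtain ⟨b', h1, h2⟩ := holds_comp.1 this
  obtain rfl := h.unique h1
  exact mem_agree.2 ⟨c, hc, h2⟩

instance : HasEqualizers DCL := by
  have (X Y : DCL) (f g : X ⟶ Y) : HasLimit (parallelPair f g) := by
    refine HasLimit.mk ⟨Fork.ofι (incl _ X (agree_sub f g)) (hom_ext fun M a b => ?_),
      Fork.IsLimit.mk _ (fun s => corestrict s.ι _ (agree_of_comp s.condition))
        (fun s => hom_ext fun M a b => ?_) (fun s m h => hom_ext fun M a b => ?_)⟩
    · simp only [holds_comp, holds_incl]
      constructor
      · rintro ⟨c, ⟨h, rfl⟩, h'⟩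
        obtain ⟨d, h1, h2⟩ := mem_agree.1 h
        obtain rfl := h'.unique h1
        exact ⟨a, ⟨h, rfl⟩, h2⟩
      · rintro ⟨c, ⟨h, rfl⟩, h'⟩
        obtain ⟨d, h1, h2⟩ := mem_agree.1 h
        obtain rfl := h'.unique h2
        exact ⟨a, ⟨h, rfl⟩, h1⟩
    · change Holds (corestrict s.ι _ (agree_of_comp s.condition) ≫ incl _ X (agree_sub f g)) a b ↔
        Holds s.ι a b
      simp only [holds_comp, holds_corestrict, holds_incl]
      constructor
      · rintro ⟨c, h, -, rfl⟩; exact h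
      · intro h; exact ⟨b, h, agree_of_comp s.condition M a b h, rfl⟩
    · have h : m ≫ incl _ X (agree_sub f g) = s.ι := h
      rw [holds_corestrict, ← h]
      simp only [holds_comp, holds_incl]
      constructor
      · intro h; exact ⟨b, h, h.dom.2, rfl⟩
      · rintro ⟨c, h, -, rfl⟩; exact h
  exact hasEqualizers_of_hasLimit_parallelPair _

instance : HasFiniteLimits DCL :=
  have : HasFiniteProducts DCL := hasFiniteProducts_of_has_binary_and_terminal
  hasFiniteLimits_of_hasEqualizers_and_finite_products

end DCL

/-! ### Algebraic set theory over a class of small maps -/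

section General

universe v u

variable {C : Type u} [Category.{v} C]

/-- An object into which every object embeds. -/
def IsUniversal (U : C) : Prop := ∀ X : C, ∃ j : X ⟶ U, Mono j

variable [HasFiniteLimits C]

/-- An object `𝒫_S(X)` of small subobjects of `X`, with its membership relation
`e : ∈_X ⟶ X ⨯ 𝒫_S(X)`: every relation `ψ : R ⟶ X ⨯ Z` whose second component is small is the
pullback of `e` along `𝟙 X × ρ` for a unique `ρ : Z ⟶ 𝒫_S(X)`. -/
structure SmallPower (S : MorphismProperty C) (X : C) where
  pow : C
  mem : C
  e : mem ⟶ X ⨯ pow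
  mono_e : Mono e
  small_e : S (e ≫ prod.snd)
  classify : ∀ {Z R : C} (ψ : R ⟶ X ⨯ Z), Mono ψ → S (ψ ≫ prod.snd) →
    ∃! ρ : Z ⟶ pow, ∃ t : R ⟶ mem, IsPullback t ψ e (prod.map (𝟙 X) ρ)

/-- `U` is a universe: `𝒫_S(U)` exists and embeds into `U`. -/
def IsUniverse (S : MorphismProperty C) (U : C) : Prop :=
  ∃ p : SmallPower S U, ∃ j : p.pow ⟶ U, Mono j

variable (C) in
/-- The data of a ZF-algebra: an object `U`, a binary relation `≤` on it, and `σ : U ⟶ U`. -/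
structure ZFData where
  U : C
  R : C
  rel : R ⟶ U ⨯ U
  σ : U ⟶ U

namespace ZFData

variable (A : ZFData C)

/-- The relation `f ≤ g` on generalized elements of `U`: `⟨f, g⟩` factors through `R`. -/
def Le {Z : C} (f g : Z ⟶ A.U) : Prop := ∃ k : Z ⟶ A.R, k ≫ A.rel = prod.lift f g

/-- `b` is an internal least element. -/
def IsBot (b : ⊤_ C ⟶ A.U) : Prop :=
  ∀ (Z : C) (f : Z ⟶ A.U), A.Le (terminal.from Z ≫ b) f

/-- `m` is an internal operation of binary suprema. -/
def IsJoin (m : A.U ⨯ A.U ⟶ A.U) : Prop :=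
  ∀ (Z : C) (f g h : Z ⟶ A.U), A.Le (prod.lift f g ≫ m) h ↔ A.Le f h ∧ A.Le g h

/-- `s` is the supremum `sup_j(l)` of `l : B ⟶ U` along `j : B ⟶ D`. -/
def IsSup {B D : C} (j : B ⟶ D) (l : B ⟶ A.U) (s : D ⟶ A.U) : Prop :=
  ∀ (B' : C) (j' : B' ⟶ D) (l' : B' ⟶ A.U),
    A.Le (j' ≫ s) l' ↔ A.Le (pullback.snd j' j ≫ l) (pullback.fst j' j ≫ l')

end ZFData

/-- `(U, ≤)` is an internal sup-semilattice and `U` has suprema along small maps. -/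
structure IsZFAlgebra (S : MorphismProperty C) (A : ZFData C) : Prop where
  mono_rel : Mono A.rel
  le_refl : ∀ {Z : C} (f : Z ⟶ A.U), A.Le f f
  le_trans : ∀ {Z : C} (f g h : Z ⟶ A.U), A.Le f g → A.Le g h → A.Le f h
  le_antisymm : ∀ {Z : C} (f g : Z ⟶ A.U), A.Le f g → A.Le g f → f = g
  exists_bot : ∃ b : ⊤_ C ⟶ A.U, A.IsBot b
  exists_join : ∃ m : A.U ⨯ A.U ⟶ A.U, A.IsJoin m
  exists_sup : ∀ {B D : C} (j : B ⟶ D), S j → ∀ l : B ⟶ A.U, ∃ s : D ⟶ A.U, A.IsSup j l s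

/-- A ZF-algebra for the class `S` of small maps. -/
structure ZFAlgebra (S : MorphismProperty C) extends ZFData C where
  isZFAlgebra : IsZFAlgebra S toZFData

/-- Morphisms of ZF-algebras: morphisms of internal sup-semilattices which preserve suprema along
small maps and commute with `σ`. -/
@[ext]
structure ZFAlgebra.Hom {S : MorphismProperty C} (A B : ZFAlgebra S) where
  hom : A.U ⟶ B.U
  map_le : ∀ {Z : C} (f g : Z ⟶ A.U), A.Le f g → B.Le (f ≫ hom) (g ≫ hom)
  map_bot : ∀ b : ⊤_ C ⟶ A.U, A.IsBot b → B.IsBot (b ≫ hom)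
  map_join : ∀ (m : A.U ⨯ A.U ⟶ A.U) (m' : B.U ⨯ B.U ⟶ B.U), A.IsJoin m → B.IsJoin m' →
    m ≫ hom = prod.map hom hom ≫ m'
  map_sup : ∀ {X D : C} (j : X ⟶ D) (l : X ⟶ A.U) (s : D ⟶ A.U), S j → A.IsSup j l s →
    B.IsSup j (l ≫ hom) (s ≫ hom)
  map_σ : A.σ ≫ hom = hom ≫ B.σ

instance (S : MorphismProperty C) : Category (ZFAlgebra S) where
  Hom A B := ZFAlgebra.Hom A B
  id A :=
    { hom := 𝟙 _
      map_le := fun f g h => by simpa using h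
      map_bot := fun b h => by simpa using h
      map_join := fun m m' h h' => by
        have : m = m' := A.isZFAlgebra.le_antisymm _ _
          (by
            have := (h _ prod.fst prod.snd m').2 ((h' _ prod.fst prod.snd m').1 (by simpa using A.isZFAlgebra.le_refl _))
            simpa using this)
          (by
            have := (h' _ prod.fst prod.snd m).2 ((h _ prod.fst prod.snd m).1 (by simpa using A.isZFAlgebra.le_refl _))
            simpa using this)
        rw [this, prod.map_id_id, Category.comp_id, Category.id_comp]
      map_sup := fun j l s _ h => by simpa using h
      map_σ := by simp }
  comp {A B D} φ χ :=
    { hom := φ.hom ≫ χ.hom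
      map_le := fun f g h => by simpa using χ.map_le _ _ (φ.map_le f g h)
      map_bot := fun b h => by simpa using χ.map_bot _ (φ.map_bot b h)
      map_join := fun m m' h h' => by
        obtain ⟨n, hn⟩ := B.isZFAlgebra.exists_join
        rw [← Category.assoc, φ.map_join m n h hn, Category.assoc, χ.map_join n m' hn h',
          ← Category.assoc, prod.map_map]
      map_sup := fun j l s hj h => by
        simpa using χ.map_sup j _ _ hj (φ.map_sup j l s hj h)
      map_σ := by rw [← Category.assoc, φ.map_σ, Category.assoc, χ.map_σ, Category.assoc] }
  id_comp φ := ZFAlgebra.Hom.ext (Category.id_comp _)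
  comp_id φ := ZFAlgebra.Hom.ext (Category.comp_id _)
  assoc φ χ ω := ZFAlgebra.Hom.ext (Category.assoc _ _ _)

end General

/-! ### Small maps and the algebra of all sets -/

namespace DCL

/-- The sentence `∀ y, ∃ z, ∀ x, F(x, y) ↔ x ∈ z`. -/
def smallF (F : LSet.Formula (Fin 1 ⊕ Fin 1)) : LSet.Sentence :=
  ∀' ∃' ∀' (inst₂ F (inr 2) (inr 0) ⇔ memF (inr 2) (inr 1))

/-- The class of small maps: `[{x, y | F}]` is small if `ZF ⊢ ∀ y, ∃ z, ∀ x, F(x, y) ↔ x ∈ z`. -/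
def smallMaps : MorphismProperty DCL := fun X Y f =>
  ∃ F : ClassFun X Y, arrow F = f ∧ ZF ⊨ᵇ smallF F.toFormula

/-- Smallness is a fibrewise condition in all models; in particular it does not depend on the
representing formula. -/
theorem smallMaps_iff {X Y : DCL} {f : X ⟶ Y} :
    smallMaps f ↔ ∀ (M : ZFModel) (b : M), ∃ z : M, ∀ a : M, Holds f a b ↔ E a z := by
  have key (F : ClassFun X Y) : ZF ⊨ᵇ smallF F.toFormula ↔
      ∀ (M : ZFModel) (b : M), ∃ z : M, ∀ a : M, Holds (arrow F) a b ↔ E a z := by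
    rw [Theory.models_sentence_iff]
    refine forall_congr' fun M => ?_
    simp only [holds_arrow]
    simp [smallF, Sentence.Realize, Formula.Realize, Fin.snoc]
  constructor
  · rintro ⟨F, rfl, h⟩
    exact (key F).1 h
  · intro h
    refine ⟨Quotient.out f.hom, arrow_out f, (key _).2 ?_⟩
    rwa [arrow_out]

/-- The class `{x | x = x}` of all sets. -/
def univ : DCL := DefClass.mk (eqF (inl 0) (inl 0))

theorem mem_univ {M : ZFModel} (a : M) : Mem univ a := by
  rw [Mem, univ, sat_iff]
  simp

/-- The formula `s ⊆ t`. -/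
def subF {α : Type} {n : ℕ} (s t : α ⊕ Fin n) : LSet.BoundedFormula α n := inst subsetF ![s, t]

@[simp] theorem realize_subF {M : ZFModel} {α : Type} {n : ℕ} {v : α → M} {xs : Fin n → M}
    (s t : α ⊕ Fin n) : (subF s t).Realize v xs ↔
      ∀ u, E u (Sum.elim v xs s) → E u (Sum.elim v xs t) := by
  rw [subF, realize_inst, comp_two]
  simp [subsetF, Formula.Realize, Fin.snoc]

/-- The class `{z | ∃ y y', z = ⟨y, y'⟩ ∧ y ⊆ y'}`. -/
def subsetClass : DCL := DefClass.mk (∃' ∃' (pairF (inl 0) (inr 0) (inr 1) ⊓ subF (inr 0) (inr 1)))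

theorem mem_subsetClass {M : ZFModel} {z : M} :
    Mem subsetClass z ↔ ∃ y y', IsPair z y y' ∧ ∀ u, E u y → E u y' := by
  rw [Mem, subsetClass, sat_iff]
  simp [Fin.snoc]

/-- The formula `{z, y | ∃ y', z = ⟨y, y'⟩ ∧ y ⊆ y'}`. -/
def subsetFst : subsetClass ⟶ univ :=
  mkHom _ _ (∃' (pairF vx vy (inr 0) ⊓ subF vy (inr 0)))
    (fun M a b h => by
      rw [sat₂_iff] at h
      simp [Fin.snoc] at h
      obtain ⟨y, h⟩ := h
      exact ⟨mem_subsetClass.2 ⟨_, _, h⟩, mem_univ b⟩)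
    (fun M a b b' h h' => by
      rw [sat₂_iff] at h h'
      simp [Fin.snoc] at h h'
      obtain ⟨y, h1, -⟩ := h
      obtain ⟨y', h1', -⟩ := h'
      exact (pair_inj h1 h1').1)
    (fun M a h => by
      obtain ⟨x, y, h⟩ := mem_subsetClass.1 h
      refine ⟨x, ?_⟩
      rw [sat₂_iff]
      simp [Fin.snoc]
      exact ⟨y, h⟩)

/-- The formula `{z, y' | ∃ y, z = ⟨y, y'⟩ ∧ y ⊆ y'}`. -/
def subsetSnd : subsetClass ⟶ univ :=
  mkHom _ _ (∃' (pairF vx (inr 0) vy ⊓ subF (inr 0) vy))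
    (fun M a b h => by
      rw [sat₂_iff] at h
      simp [Fin.snoc] at h
      obtain ⟨y, h⟩ := h
      exact ⟨mem_subsetClass.2 ⟨_, _, h⟩, mem_univ b⟩)
    (fun M a b b' h h' => by
      rw [sat₂_iff] at h h'
      simp [Fin.snoc] at h h'
      obtain ⟨y, h1, -⟩ := h
      obtain ⟨y', h1', -⟩ := h'
      exact (pair_inj h1 h1').2)
    (fun M a h => by
      obtain ⟨x, y, h⟩ := mem_subsetClass.1 h
      refine ⟨y, ?_⟩
      rw [sat₂_iff]
      simp [Fin.snoc]
      exact ⟨x, h⟩)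

/-- The arrow `[{x, z | z = {x}}]`. -/
def singleton : univ ⟶ univ :=
  mkHom _ _ (inst isSingletonF ![vy, vx])
    (fun _ a b _ => ⟨mem_univ a, mem_univ b⟩)
    (fun M a b b' h h' => by
      rw [sat₂_iff, realize_inst, comp_two] at h h'
      simp [isSingletonF, Formula.Realize, Fin.snoc] at h h'
      exact model_ext fun t => by rw [h, h'])
    (fun M a _ => by
      obtain ⟨c, hc⟩ := model_pairing a a
      refine ⟨c, ?_⟩
      rw [sat₂_iff, realize_inst, comp_two]
      simp [isSingletonF, Formula.Realize, Fin.snoc]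
      simpa using hc)

/-- The class of all sets with the subset relation and the singleton map `x ↦ {x}`. -/
noncomputable abbrev setAlgebra : ZFData DCL where
  U := univ
  R := subsetClass
  rel := prod.lift subsetFst subsetSnd
  σ := singleton

/-- The formula `{z', x | Q(z') ∧ ∀ t, t ∈ x ↔ ∃ z s, F(z, z') ∧ L(z, s) ∧ t ∈ s}`, that is,
`x = ⋃ {L(z) | F(z) = z'}`. -/
def unionF (Q : LSet.Formula (Fin 1)) (F L : LSet.Formula (Fin 1 ⊕ Fin 1)) :
    LSet.Formula (Fin 1 ⊕ Fin 1) :=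
  inst₁ Q vx ⊓ ∀' (memF (inr 0) vy ⇔
    ∃' ∃' (inst₂ F (inr 1) vx ⊓ inst₂ L (inr 1) (inr 2) ⊓ memF (inr 0) (inr 2)))

end DCL

end AST

/-! Entailment is truth in all models of ZF, so two functional formulas give the same arrow exactly
when they define the same relation in every model. Each categorical statement is therefore
translated into one about points of an arbitrary model. Separation and replacement apply only to
formulas, and an arrow must be given by one formula valid in all models; `UDef` records this uniform
definability, and instance search assembles the formulas.

The translation rests on `IsGraph`. By `exists_isGraph` every definable binary relation is an object
with two projections. A condition on generalized elements can then be tested at a single point: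
apply it to the generic stage, the class of all pairs satisfying the hypothesis, and evaluate.
Products, pullbacks, monos, least elements, joins and suprema all become pointwise notions in this
way.

A small relation on `V` over `Z` has sets as fibres, so `V` with the membership relation is its own
object of small subobjects, with `z ↦ {x | R(x, z)}` as classifying map. Suprema for inclusion are
unions, which exist along small maps by replacement and union.

For initiality, every set is the union of the singletons of its members. Hence a morphism `h` from
`V` to an algebra must satisfy `h(x) = sup {σ(h(y)) | y ∈ x}` (`ZFAlgebra.Hom.isFold`). By
∈-induction there is at most one such `h`, and ∈-recursion provides one. Conversely, its value at
`x` depends only on the members of `x`, so it turns unions into suprema and `{x}` into `σ(h(x))`.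

Recursion has to be derived from the axioms, and there is a circle to break: deducing ∈-induction
from foundation requires transitive supersets, which are themselves built by recursion. Induction
and recursion are therefore proved relative to a class `T` whose members have transitive supersets.
They are used first for transitive sets of transitive sets, which are their own transitive
supersets; this yields `model_transitive`, after which `T` can be everything. -/

namespace AST

/-! ### Uniformly definable predicates -/

/-- A predicate on tuples of elements of models of ZF is uniformly definable if a single formula
defines it in all models. -/
class UDef {n : ℕ} (P : ∀ M : ZFModel, (Fin n → M) → Prop) : Prop where
  out : ∃ φ : LSet.Formula (Fin n), ∀ (M : ZFModel) (v : Fin n → M), φ.Realize v ↔ P M v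

namespace UDef

variable {n : ℕ} {P Q : ∀ M : ZFModel, (Fin n → M) → Prop}

instance mem (i j : Fin n) : UDef fun M (v : Fin n → M) => E (v i) (v j) :=
  ⟨memF (inl i) (inl j), fun M v => by simp [Formula.Realize]⟩

instance eq (i j : Fin n) : UDef fun M (v : Fin n → M) => v i = v j :=
  ⟨eqF (inl i) (inl j), fun M v => by simp [Formula.Realize]⟩

instance holds {X Y : DCL} (f : X ⟶ Y) (i j : Fin n) :
    UDef fun M (v : Fin n → M) => Holds f (v i) (v j) :=
  ⟨inst₂ (rep f) (inl i) (inl j), fun M v => by simp [Formula.Realize, Holds]⟩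

instance memClass (X : DCL) (i : Fin n) : UDef fun M (v : Fin n → M) => Mem X (v i) :=
  ⟨inst₁ (DefClass.formula X) (inl i), fun M v => by simp [Formula.Realize, Mem]⟩

instance isPair (i j k : Fin n) : UDef fun M (v : Fin n → M) => IsPair (v i) (v j) (v k) :=
  ⟨pairF (inl i) (inl j) (inl k), fun M v => by simp [Formula.Realize]⟩

instance true : UDef fun M (_ : Fin n → M) => True :=
  ⟨⊤, fun M v => by simp⟩

instance not [hP : UDef P] : UDef fun M v => ¬ P M v := by
  obtain ⟨φ, hφ⟩ := hP.out
  exact ⟨φ.not, fun M v => by rw [Formula.realize_not, hφ]⟩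

instance and [hP : UDef P] [hQ : UDef Q] : UDef fun M v => P M v ∧ Q M v := by
  obtain ⟨φ, hφ⟩ := hP.out
  obtain ⟨ψ, hψ⟩ := hQ.out
  exact ⟨φ ⊓ ψ, fun M v => by rw [Formula.realize_inf, hφ, hψ]⟩

instance or [hP : UDef P] [hQ : UDef Q] : UDef fun M v => P M v ∨ Q M v := by
  obtain ⟨φ, hφ⟩ := hP.out
  obtain ⟨ψ, hψ⟩ := hQ.out
  exact ⟨φ ⊔ ψ, fun M v => by rw [Formula.realize_sup, hφ, hψ]⟩

instance imp [hP : UDef P] [hQ : UDef Q] : UDef fun M v => P M v → Q M v := by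
  obtain ⟨φ, hφ⟩ := hP.out
  obtain ⟨ψ, hψ⟩ := hQ.out
  exact ⟨φ.imp ψ, fun M v => by rw [Formula.realize_imp, hφ, hψ]⟩

instance iff [hP : UDef P] [hQ : UDef Q] : UDef fun M v => P M v ↔ Q M v := by
  obtain ⟨φ, hφ⟩ := hP.out
  obtain ⟨ψ, hψ⟩ := hQ.out
  exact ⟨φ.iff ψ, fun M v => by rw [Formula.realize_iff, hφ, hψ]⟩

theorem subst {m : ℕ} {P : ∀ M : ZFModel, (Fin m → M) → Prop} (hP : UDef P) (g : Fin m → Fin n) :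
    UDef fun M (v : Fin n → M) => P M (fun i => v (g i)) := by
  obtain ⟨φ, hφ⟩ := hP.out
  exact ⟨φ.relabel g, fun M v => Formula.realize_relabel.trans (hφ M _)⟩

/-- The bound variable is the last coordinate of a tuple longer by one. Instance search can thus
strip quantifiers from a predicate one at a time and reach the atomic cases, whose variables are
arbitrary coordinates. -/
instance all {Q : ∀ M : ZFModel, (Fin n → M) → M → Prop}
    [hQ : UDef fun M (v : Fin (n + 1) → M) => Q M (fun i => v i.castSucc) (v (Fin.last n))] :
    UDef fun M v => ∀ x : M, Q M v x := by
  obtain ⟨φ, hφ⟩ := hQ.out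
  refine ⟨∀' (inst φ (Fin.snoc (α := fun _ => Fin n ⊕ Fin 1) inl (inr 0))), fun M v => ?_⟩
  simp only [Formula.Realize, BoundedFormula.realize_all, realize_inst]
  refine forall_congr' fun x => ?_
  refine Iff.trans (hφ M _) ?_
  simp [Fin.snoc]

instance ex {Q : ∀ M : ZFModel, (Fin n → M) → M → Prop}
    [hQ : UDef fun M (v : Fin (n + 1) → M) => Q M (fun i => v i.castSucc) (v (Fin.last n))] :
    UDef fun M v => ∃ x : M, Q M v x := by
  have : UDef fun M v => ¬ ∀ x : M, ¬ Q M v x := inferInstance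
  simpa only [not_forall, not_not] using this

end UDef

/-! ### The axioms of ZF in a model, for uniformly definable predicates -/

section

variable {n : ℕ} {M : ZFModel}

theorem realize_relabel_snoc (φ : LSet.Formula (Fin (n + 1))) (w : Fin n ⊕ Fin 1 → M) :
    BoundedFormula.Realize (φ.relabel (Fin.snoc (α := fun _ => Fin n ⊕ Fin 1) inl (inr 0))) w
      default ↔ φ.Realize (Fin.snoc (α := fun _ => M) (w ∘ inl) (w (inr 0))) := by
  refine Formula.realize_relabel.trans (iff_of_eq (congrArg _ ?_))
  funext i
  refine Fin.lastCases ?_ (fun i => ?_) i <;> simp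

theorem realize_relabel_snoc_snoc (φ : LSet.Formula (Fin (n + 2))) (w : Fin n ⊕ Fin 2 → M) :
    BoundedFormula.Realize (φ.relabel (Fin.snoc (α := fun _ => Fin n ⊕ Fin 2)
      (Fin.snoc (α := fun _ => Fin n ⊕ Fin 2) inl (inr 0)) (inr 1))) w default ↔
      φ.Realize (Fin.snoc (α := fun _ => M) (Fin.snoc (α := fun _ => M) (w ∘ inl) (w (inr 0)))
        (w (inr 1))) := by
  refine Formula.realize_relabel.trans (iff_of_eq (congrArg _ ?_))
  funext i
  refine Fin.lastCases ?_ (fun i => ?_) i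
  · simp
  · refine Fin.lastCases ?_ (fun i => ?_) i <;> simp

theorem model_sep (P : ∀ M : ZFModel, (Fin n → M) → M → Prop)
    [hP : UDef fun M (v : Fin (n + 1) → M) => P M (fun i => v i.castSucc) (v (Fin.last n))]
    (v : Fin n → M) (a : M) : ∃ b : M, ∀ t : M, E t b ↔ E t a ∧ P M v t := by
  obtain ⟨φ, hφ⟩ := hP.out
  have key (x : M) : φ.Realize (Fin.snoc (α := fun _ => M) v x) ↔ P M v x := by
    rw [hφ]; simp
  have := model_axiom M
    (.separation (φ.relabel (Fin.snoc (α := fun _ => Fin n ⊕ Fin 1) inl (inr 0))))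
  simp only [axSeparation, univClosure, Sentence.Realize, Formula.realize_iAlls,
    Formula.realize_relabel] at this
  replace this := this v
  simp only [Formula.Realize, BoundedFormula.realize_all, BoundedFormula.realize_ex,
    BoundedFormula.realize_iff, BoundedFormula.realize_inf, realize_memF, realize_inst,
    realize_relabel_snoc] at this
  simp only [Fin.snoc, Function.comp_def, Sum.elim_inl, Sum.elim_inr] at this
  obtain ⟨b, hb⟩ := this a
  exact ⟨b, fun t => (hb t).trans (and_congr_right fun _ => key t)⟩

/-- The axiom only provides a set containing every value, possibly with further elements. The exact
image is cut out of it by separation, and uniqueness of values shows that nothing is lost. -/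
theorem model_repl (F : ∀ M : ZFModel, (Fin n → M) → M → M → Prop)
    [hF : UDef fun M (v : Fin (n + 2) → M) =>
      F M (fun i => v i.castSucc.castSucc) (v (Fin.last n).castSucc) (v (Fin.last (n + 1)))]
    (v : Fin n → M) (a : M) (h : ∀ x, E x a → ∃! y, F M v x y) :
    ∃ b : M, ∀ y : M, E y b ↔ ∃ x, E x a ∧ F M v x y := by
  obtain ⟨φ, hφ⟩ := hF.out
  have key (x y : M) : φ.Realize (Fin.snoc (α := fun _ => M) (Fin.snoc (α := fun _ => M) v x) y) ↔
      F M v x y := by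
    rw [hφ]; simp
  have := model_axiom M (.replacement (φ.relabel
    (Fin.snoc (α := fun _ => Fin n ⊕ Fin 2)
      (Fin.snoc (α := fun _ => Fin n ⊕ Fin 2) inl (inr 0)) (inr 1))))
  simp only [axReplacement, univClosure, Sentence.Realize, Formula.realize_iAlls,
    Formula.realize_relabel] at this
  replace this := this v
  simp only [Formula.Realize, BoundedFormula.realize_all, BoundedFormula.realize_ex,
    BoundedFormula.realize_imp, BoundedFormula.realize_inf, realize_memF, realize_eqF,
    realize_inst, realize_relabel_snoc_snoc] at this
  simp only [Fin.snoc, Function.comp_def, Sum.elim_inl, Sum.elim_inr] at this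
  obtain ⟨b, hb⟩ := this a fun x hx => by
    obtain ⟨y, hy, hu⟩ := h x hx
    exact ⟨y, (key x y).2 hy, fun z hz => hu z ((key x z).1 hz)⟩
  -- The coordinates here are the parameters, then `a`, then `y`, with the bound `x` last. `F`
  -- expects `x` before `y` and no `a`, which the substitution arranges.
  have : UDef fun M (w : Fin (n + 2) → M) => ∃ x, E x (w (Fin.last n).castSucc) ∧
      F M (fun i => w i.castSucc.castSucc) x (w (Fin.last (n + 1))) := by
    have := hF.subst (Fin.snoc (α := fun _ => Fin (n + 3)) (Fin.snoc (α := fun _ => Fin (n + 3))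
      (fun i => i.castSucc.castSucc.castSucc) (Fin.last (n + 2))) (Fin.last (n + 1)).castSucc)
    simp only [Fin.snoc_last, Fin.snoc_castSucc] at this
    infer_instance
  obtain ⟨c, hc⟩ := model_sep (n := n + 1) (fun M w y => ∃ x, E x (w (Fin.last n)) ∧
    F M (fun i => w i.castSucc) x y) (Fin.snoc (α := fun _ => M) v a) b
  refine ⟨c, fun y => ?_⟩
  rw [hc]
  simp only [Fin.snoc_last, Fin.snoc_castSucc]
  refine ⟨fun h => h.2, fun ⟨x, hx, hy⟩ => ⟨?_, x, hx, hy⟩⟩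
  obtain ⟨y', hy', hF'⟩ := hb x hx
  rwa [(h x hx).unique hy ((key x y').1 hF')]

theorem model_union (a : M) : ∃ c : M, ∀ t : M, E t c ↔ ∃ y, E t y ∧ E y a := by
  have := model_axiom M .union
  simp [axUnion, Sentence.Realize, Formula.Realize, Fin.snoc] at this
  exact this a

theorem model_union₂ (a b : M) : ∃ c : M, ∀ t : M, E t c ↔ E t a ∨ E t b := by
  obtain ⟨p, hp⟩ := model_pairing a b
  obtain ⟨c, hc⟩ := model_union p
  refine ⟨c, fun t => (hc t).trans ⟨?_, ?_⟩⟩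
  · rintro ⟨y, hy, h⟩
    rcases (hp y).1 h with rfl | rfl
    exacts [.inl hy, .inr hy]
  · rintro (h | h)
    exacts [⟨a, h, (hp a).2 (.inl rfl)⟩, ⟨b, h, (hp b).2 (.inr rfl)⟩]

theorem model_foundation {a t : M} (h : E t a) : ∃ z, E z a ∧ ∀ t, E t a → ¬ E t z := by
  have := model_axiom M .foundation
  simp [axFoundation, Sentence.Realize, Formula.Realize, Fin.snoc, isEmptyF] at this
  exact this a t h

theorem model_infinity (M : ZFModel) : ∃ a : M, (∃ c, (∀ t, ¬ E t c) ∧ E c a) ∧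
    ∀ t, E t a → ∃ s, (∀ u, E u s ↔ E u t ∨ u = t) ∧ E s a := by
  have := model_axiom M .infinity
  simp [axInfinity, Sentence.Realize, Formula.Realize, Fin.snoc, isEmptyF, isSuccF] at this
  exact this

end

/-! ### Transitive sets, induction and recursion -/

section

variable {M : ZFModel}

/-- `t` is a transitive set. -/
def IsTrans (t : M) : Prop := ∀ a b, E a b → E b t → E a t

instance UDef.isTrans {n : ℕ} (i : Fin n) : UDef fun M (v : Fin n → M) => IsTrans (v i) := by
  unfold IsTrans; infer_instance

/-- `∈`-induction inside a downward closed class `T` whose members lie below transitive sets. -/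
theorem model_induction {n : ℕ} {T : ∀ M : ZFModel, M → Prop}
    [hT : ∀ n (i : Fin n), UDef fun M (v : Fin n → M) => T M (v i)]
    (hdown : ∀ x : M, T M x → ∀ y, E y x → T M y)
    (htrans : ∀ x : M, T M x → ∃ t, IsTrans t ∧ ∀ y, E y x → E y t)
    (P : ∀ M : ZFModel, (Fin n → M) → M → Prop)
    [hP : UDef fun M (v : Fin (n + 1) → M) => P M (fun i => v i.castSucc) (v (Fin.last n))]
    (v : Fin n → M) (h : ∀ x, T M x → (∀ y, E y x → P M v y) → P M v x) (x : M) (hx : T M x) :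
    P M v x := by
  by_contra hn
  obtain ⟨t, ht, hxt⟩ := htrans x hx
  obtain ⟨y, hy, hyn⟩ : ∃ y, E y x ∧ ¬ P M v y := by
    by_contra! hc
    exact hn (h x hx hc)
  -- The counterexamples in `t` form a set, nonempty because of `y`. All members of an ∈-minimal one
  -- lie in `t` and in `T`, so they satisfy `P`, and `h` applies to it.
  obtain ⟨b, hb⟩ := model_sep (fun M v z => T M z ∧ ¬ P M v z) v t
  obtain ⟨z, hz, hmin⟩ := model_foundation ((hb y).2 ⟨hxt y hy, hdown x hx y hy, hyn⟩)
  obtain ⟨hzt, hTz, hPz⟩ := (hb z).1 hz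
  refine hPz (h z hTz fun w hw => ?_)
  by_contra hc
  exact hmin w ((hb w).2 ⟨ht w z hw hzt, hdown z hTz w hw, hc⟩) hw

/-- `d = f[x]`, the image of `x` under the set of pairs `f`. -/
def IsImage (f x d : M) : Prop := ∀ w, E w d ↔ ∃ y p, E y x ∧ IsPair p y w ∧ E p f

instance UDef.isImage {n : ℕ} (i j k : Fin n) :
    UDef fun M (v : Fin n → M) => IsImage (v i) (v j) (v k) := by
  unfold IsImage; infer_instance

/-- `f` is an attempt at the recursion `h(x) = G(p, h[x])`: a set whose pairs `⟨x, w⟩` satisfy the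
recursion, all members of `x` being in its domain. -/
def IsAttempt (G : ∀ M : ZFModel, M → M → M → Prop) (p f : M) : Prop :=
  ∀ q x w, IsPair q x w → E q f →
    (∀ y, E y x → ∃ r z, IsPair r y z ∧ E r f) ∧ ∃ d, IsImage f x d ∧ G M p d w

/-- The relation `h(x) = w`, where `h` is defined by the recursion `h(x) = G(p, h[x])`. -/
def RecRel (G : ∀ M : ZFModel, M → M → M → Prop) (p x w : M) : Prop :=
  ∃ f q, IsAttempt G p f ∧ IsPair q x w ∧ E q f

variable {G : ∀ M : ZFModel, M → M → M → Prop}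
  [hG : ∀ n (i j k : Fin n), UDef fun M (v : Fin n → M) => G M (v i) (v j) (v k)]

instance UDef.isAttempt {n : ℕ} (i j : Fin n) :
    UDef fun M (v : Fin n → M) => IsAttempt G (v i) (v j) := by
  unfold IsAttempt; infer_instance

instance UDef.recRel {n : ℕ} (i j k : Fin n) :
    UDef fun M (v : Fin n → M) => RecRel G (v i) (v j) (v k) := by
  unfold RecRel; infer_instance

end

/-! ### Recursion along membership, and transitive supersets -/

theorem IsAttempt.recRel {M : ZFModel} {G : ∀ M : ZFModel, M → M → M → Prop} {p f q x w : M}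
    (hf : IsAttempt G p f) (hq : IsPair q x w) (hqf : E q f) : RecRel G p x w :=
  ⟨f, q, hf, hq, hqf⟩

section

variable {M : ZFModel} {G : ∀ M : ZFModel, M → M → M → Prop}
  [hG : ∀ n (i j k : Fin n), UDef fun M (v : Fin n → M) => G M (v i) (v j) (v k)]
  {T : ∀ M : ZFModel, M → Prop} [hT : ∀ n (i : Fin n), UDef fun M (v : Fin n → M) => T M (v i)]

/-- By ∈-induction two attempts agree on the members of `x`, and both are defined on all of them.
The images of `x` under the two attempts are then equal, and `G` is single-valued. -/
theorem RecRel.unique {p : M} (hdown : ∀ x : M, T M x → ∀ y, E y x → T M y)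
    (htrans : ∀ x : M, T M x → ∃ t, IsTrans t ∧ ∀ y, E y x → E y t)
    (hfun : ∀ d w w', G M p d w → G M p d w' → w = w')
    {x w w' : M} (hx : T M x) (h : RecRel G p x w) (h' : RecRel G p x w') : w = w' := by
  refine model_induction hdown htrans
    (fun M v x => ∀ w w', RecRel G (v 0) x w → RecRel G (v 0) x w' → w = w') ![p] ?_ x hx w w' h h'
  clear! x w w'
  rintro x - ih w w' ⟨f, q, hf, hq, hqf⟩ ⟨f', q', hf', hq', hqf'⟩
  obtain ⟨h1, d, hd, hg⟩ := hf q x w hq hqf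
  obtain ⟨h1', d', hd', hg'⟩ := hf' q' x w' hq' hqf'
  have key {g g' c c' : M} (hg : IsAttempt G p g) (hg' : IsAttempt G p g') (hc : IsImage g x c)
      (hc' : IsImage g' x c') (h : ∀ y, E y x → ∃ r z, IsPair r y z ∧ E r g') {t : M}
      (ht : E t c) : E t c' := by
    obtain ⟨y, r, hy, hr, hrg⟩ := (hc t).1 ht
    obtain ⟨r', z, hr', hrg'⟩ := h y hy
    obtain rfl : t = z := ih y hy t z (hg.recRel hr hrg) (hg'.recRel hr' hrg')
    exact (hc' t).2 ⟨y, r', hy, hr', hrg'⟩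
  obtain rfl : d = d' := model_ext fun t =>
    ⟨key hf hf' hd hd' h1', key hf' hf hd' hd h1⟩
  exact hfun d w w' hg hg'

/-- An attempt witnessing the value at `x` is already defined on all members of `x`. By uniqueness
its image of `x` is the set of all recursive values there, so the recursion equation can be stated
without attempts. -/
theorem RecRel.exists_image {p : M} (hdown : ∀ x : M, T M x → ∀ y, E y x → T M y)
    (htrans : ∀ x : M, T M x → ∃ t, IsTrans t ∧ ∀ y, E y x → E y t)
    (hfun : ∀ d w w', G M p d w → G M p d w' → w = w')
    {x w : M} (hx : T M x) (h : RecRel G p x w) :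
    (∀ y, E y x → ∃ u, RecRel G p y u) ∧
      ∃ d, (∀ t, E t d ↔ ∃ y, E y x ∧ RecRel G p y t) ∧ G M p d w := by
  obtain ⟨f, q, hf, hq, hqf⟩ := h
  obtain ⟨h1, d, hd, hg⟩ := hf q x w hq hqf
  refine ⟨fun y hy => ?_, d, fun t => (hd t).trans ⟨?_, ?_⟩, hg⟩
  · obtain ⟨r, z, hr, hrf⟩ := h1 y hy
    exact ⟨z, hf.recRel hr hrf⟩
  · rintro ⟨y, r, hy, hr, hrf⟩
    exact ⟨y, hy, hf.recRel hr hrf⟩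
  · rintro ⟨y, hy, ht⟩
    obtain ⟨r, z, hr, hrf⟩ := h1 y hy
    obtain rfl := RecRel.unique hdown htrans hfun (hdown x hx y hy) ht (hf.recRel hr hrf)
    exact ⟨y, r, hy, hr, hrf⟩

/-- If all members of `x` have values, take the graph `f₀` of the recursion on those points of a
transitive superset `t` that have one, and add the pair of `x` and the value that `G` prescribes for
the image of `x`. The result is an attempt. The argument is by contradiction so that `x` may be
assumed to have no value yet. -/
theorem RecRel.exists {p : M} (hdown : ∀ x : M, T M x → ∀ y, E y x → T M y)
    (htrans : ∀ x : M, T M x → ∃ t, IsTrans t ∧ ∀ y, E y x → E y t)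
    (hfun : ∀ d w w', G M p d w → G M p d w' → w = w') (htot : ∀ d, ∃ w, G M p d w)
    {x : M} (hx : T M x) : ∃ w, RecRel G p x w := by
  refine model_induction hdown htrans (fun M v x => ∃ w, RecRel G (v 0) x w) ![p] ?_ x hx
  clear! x
  intro x hx ih
  change ∀ y, E y x → ∃ w, RecRel G p y w at ih
  change ∃ w, RecRel G p x w
  have uniq {y u u'} (hy : T M y) (h : RecRel G p y u) (h' : RecRel G p y u') : u = u' :=
    RecRel.unique hdown htrans hfun hy h h'
  by_contra hn
  obtain ⟨t, ht, hxt⟩ := htrans x hx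
  obtain ⟨t', ht'⟩ := model_sep (n := 1) (fun M v z => T M z ∧ ∃ w, RecRel G (v 0) z w) ![p] t
  replace ht' : ∀ z, E z t' ↔ E z t ∧ T M z ∧ ∃ w, RecRel G p z w := ht'
  obtain ⟨f₀, hf₀⟩ := model_repl (n := 1) (fun M v z q => ∃ w, RecRel G (v 0) z w ∧ IsPair q z w) ![p] t'
    fun z hz => by
      obtain ⟨-, hTz, w, hw⟩ := (ht' z).1 hz
      obtain ⟨q, hq⟩ := pair_exists z w
      refine ⟨q, ⟨w, hw, hq⟩, fun q' ⟨w', hw', hq'⟩ => ?_⟩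
      obtain rfl := uniq hTz hw hw'
      exact pair_unique hq' hq
  replace hf₀ : ∀ q, E q f₀ ↔ ∃ z, E z t' ∧ ∃ w, RecRel G p z w ∧ IsPair q z w := hf₀
  obtain ⟨d, hd⟩ := model_repl (n := 1) (fun M v z w => RecRel G (v 0) z w) ![p] x fun z hz => by
    obtain ⟨w, hw⟩ := ih z hz
    exact ⟨w, hw, fun w' hw' => uniq (hdown x hx z hz) hw' hw⟩
  replace hd : ∀ w, E w d ↔ ∃ z, E z x ∧ RecRel G p z w := hd
  obtain ⟨w, hw⟩ := htot d
  obtain ⟨q, hq⟩ := pair_exists x w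
  obtain ⟨s, hs⟩ := model_pairing q q
  obtain ⟨f, hf⟩ := model_union₂ f₀ s
  replace hf : ∀ r, E r f ↔ E r f₀ ∨ r = q := fun r => by rw [hf, hs, or_self]
  have hfRel {r y u} (hr : IsPair r y u) (hyx : y ≠ x) : E r f → RecRel G p y u := by
    intro h
    rcases (hf r).1 h with h | rfl
    · obtain ⟨z, -, w, hw, hr'⟩ := (hf₀ r).1 h
      obtain ⟨rfl, rfl⟩ := pair_inj hr hr'
      exact hw
    · exact absurd (pair_inj hr hq).1 hyx
  have hfMem {y u} (hy : E y t) (hTy : T M y) (h : RecRel G p y u) :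
      ∃ r, IsPair r y u ∧ E r f := by
    obtain ⟨r, hr⟩ := pair_exists y u
    exact ⟨r, hr, (hf r).2 (.inl ((hf₀ r).2 ⟨y, (ht' y).2 ⟨hy, hTy, u, h⟩, u, h, hr⟩))⟩
  have key {z e u} (hz : ∀ y, E y z → E y t) (hTz : T M z) (h1 : ∀ y, E y z → ∃ u, RecRel G p y u)
      (he : ∀ w, E w e ↔ ∃ y, E y z ∧ RecRel G p y w) (hu : G M p e u) :
      (∀ y, E y z → ∃ r u, IsPair r y u ∧ E r f) ∧ ∃ d, IsImage f z d ∧ G M p d u := by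
    refine ⟨fun y hy => ?_, e, fun w => (he w).trans ⟨?_, ?_⟩, hu⟩
    · obtain ⟨u, hu⟩ := h1 y hy
      obtain ⟨r, hr⟩ := hfMem (hz y hy) (hdown z hTz y hy) hu
      exact ⟨r, u, hr⟩
    · rintro ⟨y, hy, hw⟩
      obtain ⟨r, hr⟩ := hfMem (hz y hy) (hdown z hTz y hy) hw
      exact ⟨y, r, hy, hr⟩
    · rintro ⟨y, r, hy, hr, hrf⟩
      -- The added pair never affects an image of `z`: every member of `z` has a value, whereas `x`
      -- has none, so `x` is not a member of `z`.
      refine ⟨y, hy, hfRel hr ?_ hrf⟩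
      rintro rfl
      exact hn (h1 y hy)
  refine hn ⟨w, f, q, fun r z u hr hrf => ?_, hq, (hf q).2 (.inr rfl)⟩
  rcases (hf r).1 hrf with h | rfl
  · obtain ⟨z', hz', u', hu', hr'⟩ := (hf₀ r).1 h
    obtain ⟨rfl, rfl⟩ := pair_inj hr hr'
    obtain ⟨hzt, hTz, -⟩ := (ht' z).1 hz'
    obtain ⟨h1, e, he, hu⟩ := RecRel.exists_image hdown htrans hfun hTz hu'
    exact key (fun y hy => ht y z hy hzt) hTz h1 he hu
  · obtain ⟨rfl, rfl⟩ := pair_inj hr hq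
    exact key hxt hx ih hd hw

/-- There is a nonempty set of transitive sets of transitive sets without `∈`-maximal element. -/
theorem model_ordinals (M : ZFModel) : ∃ a : M, (∃ c, E c a ∧ ∀ t, ¬ E t c) ∧
    (∀ x, E x a → (IsTrans x ∧ ∀ y, E y x → IsTrans y) ∧ ∃ y, E x y ∧ E y a) := by
  obtain ⟨i, ⟨c, hc, hci⟩, hi⟩ := model_infinity M
  -- The required condition contains the empty set and is preserved by successor, so the part of an
  -- inductive set that it cuts out again has both closure properties; `x ∈ x ∪ {x}` excludes
  -- maximal elements.
  obtain ⟨a, ha⟩ := model_sep (fun M (_ : Fin 0 → M) x => IsTrans x ∧ ∀ y, E y x → IsTrans y) ![] i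
  refine ⟨a, ⟨c, (ha c).2 ⟨hci, fun _ b _ h => absurd h (hc b), fun y h => absurd h (hc y)⟩, hc⟩,
    fun x hx => ⟨((ha x).1 hx).2, ?_⟩⟩
  obtain ⟨hxi, hx1, hx2⟩ := (ha x).1 hx
  obtain ⟨s, hs, hsi⟩ := hi x hxi
  refine ⟨s, (hs x).2 (.inr rfl), (ha s).2 ⟨hsi, fun y z hy hz => ?_, fun y hy => ?_⟩⟩
  · rcases (hs z).1 hz with hz | rfl
    exacts [(hs y).2 (.inl (hx1 y z hy hz)), (hs y).2 (.inl hy)]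
  · rcases (hs y).1 hy with hy | rfl
    exacts [hx2 y hy, hx1]

/-- The stages `h(x) = a ∪ ⋃⋃ h[x]` are defined by recursion over transitive sets of transitive
sets, and `t` is the union of the stages indexed by the set from `model_ordinals`. If `u ∈ b ∈ h(x)`
and `x ∈ x'`, then `u ∈ h(x')`; such an `x'` exists because the index set has no maximal element. -/
theorem model_transitive (a : M) : ∃ t, IsTrans t ∧ ∀ y, E y a → E y t := by
  let T : ∀ M : ZFModel, M → Prop := fun M x => IsTrans x ∧ ∀ y, E y x → IsTrans y
  let G : ∀ M : ZFModel, M → M → M → Prop :=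
    fun M p d w => ∀ u, E u w ↔ E u p ∨ ∃ c b, E c d ∧ E b c ∧ E u b
  have hT : ∀ n (i : Fin n), UDef fun M (v : Fin n → M) => T M (v i) := fun n i => by
    dsimp only [T]; infer_instance
  have hG : ∀ n (i j k : Fin n), UDef fun M (v : Fin n → M) => G M (v i) (v j) (v k) :=
    fun n i j k => by dsimp only [G]; infer_instance
  have hdown : ∀ x : M, T M x → ∀ y, E y x → T M y := fun x hx y hy =>
    ⟨hx.2 y hy, fun z hz => hx.2 z (hx.1 z y hz hy)⟩
  have htrans : ∀ x : M, T M x → ∃ t, IsTrans t ∧ ∀ y, E y x → E y t := fun x hx =>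
    ⟨x, hx.1, fun _ h => h⟩
  have hfun : ∀ d w w', G M a d w → G M a d w' → w = w' := fun d w w' h h' =>
    model_ext fun u => (h u).trans (h' u).symm
  have htot : ∀ d, ∃ w, G M a d w := fun d => by
    obtain ⟨e, he⟩ := model_union d
    obtain ⟨e', he'⟩ := model_union e
    obtain ⟨w, hw⟩ := model_union₂ a e'
    refine ⟨w, fun u => ?_⟩
    rw [hw, he']
    refine or_congr_right ⟨?_, ?_⟩
    · rintro ⟨b, hu, hb⟩
      obtain ⟨c, hc, h⟩ := (he b).1 hb
      exact ⟨c, b, h, hc, hu⟩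
    · rintro ⟨c, b, h, hc, hu⟩
      exact ⟨b, hu, (he b).2 ⟨c, hc, h⟩⟩
  obtain ⟨o, ⟨c, hco, -⟩, ho⟩ := model_ordinals M
  obtain ⟨s, hs⟩ := model_repl (n := 1) (fun M v x w => RecRel G (v 0) x w) ![a] o fun x hx => by
    obtain ⟨w, hw⟩ := RecRel.exists hdown htrans hfun htot (ho x hx).1
    exact ⟨w, hw, fun w' hw' => RecRel.unique hdown htrans hfun (ho x hx).1 hw' hw⟩
  replace hs : ∀ w, E w s ↔ ∃ x, E x o ∧ RecRel G a x w := hs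
  obtain ⟨t, ht⟩ := model_union s
  refine ⟨t, fun u b hu hb => ?_, fun y hy => ?_⟩
  · obtain ⟨w, hbw, hw⟩ := (ht b).1 hb
    obtain ⟨x, hx, hxw⟩ := (hs w).1 hw
    obtain ⟨-, x', hxx', hx'⟩ := ho x hx
    obtain ⟨w', hw'⟩ := RecRel.exists hdown htrans hfun htot (ho x' hx').1
    obtain ⟨-, d, hd, hg⟩ := RecRel.exists_image hdown htrans hfun (ho x' hx').1 hw'
    exact (ht u).2 ⟨w', (hg u).2 (.inr ⟨w, b, (hd w).2 ⟨x, hxx', hxw⟩, hbw, hu⟩),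
      (hs w').2 ⟨x', hx', hw'⟩⟩
  · obtain ⟨w, hw⟩ := RecRel.exists hdown htrans hfun htot (ho c hco).1
    obtain ⟨-, d, -, hg⟩ := RecRel.exists_image hdown htrans hfun (ho c hco).1 hw
    exact (ht y).2 ⟨w, (hg y).2 (.inl hy), (hs w).2 ⟨c, hco, hw⟩⟩

/-- `∈`-induction in models of ZF. -/
theorem mem_induction {n : ℕ} (P : ∀ M : ZFModel, (Fin n → M) → M → Prop)
    [hP : UDef fun M (v : Fin (n + 1) → M) => P M (fun i => v i.castSucc) (v (Fin.last n))]
    (v : Fin n → M) (h : ∀ x, (∀ y, E y x → P M v y) → P M v x) (x : M) : P M v x :=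
  model_induction (T := fun _ _ => True) (fun _ _ _ _ => trivial)
    (fun x _ => model_transitive x) P v (fun x _ => h x) x trivial

/-- `∈`-recursion in models of ZF. -/
theorem mem_recursion {p : M} (hfun : ∀ d, ∃! w, G M p d w) (x : M) :
    ∃! w, RecRel G p x w := by
  obtain ⟨w, hw⟩ := RecRel.exists (G := G) (T := fun _ _ => True) (fun _ _ _ _ => trivial)
    (fun x _ => model_transitive x) (fun d _ _ => (hfun d).unique) (fun d => (hfun d).exists)
    (x := x) trivial
  exact ⟨w, hw, fun w' hw' => RecRel.unique (T := fun _ _ => True) (fun _ _ _ _ => trivial)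
    (fun x _ => model_transitive x) (fun d _ _ => (hfun d).unique) trivial hw' hw⟩

theorem RecRel.image {p : M} (hfun : ∀ d, ∃! w, G M p d w) {x w : M} (h : RecRel G p x w) :
    ∃ d, (∀ t, E t d ↔ ∃ y, E y x ∧ RecRel G p y t) ∧ G M p d w :=
  (RecRel.exists_image (T := fun _ _ => True) (fun _ _ _ _ => trivial)
    (fun x _ => model_transitive x) (fun d _ _ => (hfun d).unique) trivial h).2

end

namespace DCL

/-! ### Definable classes and arrows through their extensions in models -/

/-- Definability is assumed for every arity and every choice of variable so that instance search can
supply and reuse it in any context; the formula itself is read off at arity one. -/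
theorem exists_class (P : ∀ M : ZFModel, M → Prop)
    [hP : ∀ n (i : Fin n), UDef fun M (v : Fin n → M) => P M (v i)] :
    ∃ X : DCL, ∀ (M : ZFModel) (a : M), Mem X a ↔ P M a := by
  obtain ⟨φ, hφ⟩ := (hP 1 0).out
  exact ⟨DefClass.mk φ, fun M a => hφ M _⟩

theorem exists_hom (X Y : DCL) (F : ∀ M : ZFModel, M → M → Prop)
    [hF : ∀ n (i j : Fin n), UDef fun M (v : Fin n → M) => F M (v i) (v j)]
    (hdom : ∀ (M : ZFModel) (a b : M), F M a b → Mem X a ∧ Mem Y b)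
    (hfun : ∀ (M : ZFModel) (a : M), Mem X a → ∃! b, F M a b) :
    ∃ f : X ⟶ Y, ∀ (M : ZFModel) (a b : M), Holds f a b ↔ F M a b := by
  obtain ⟨φ, hφ⟩ := (hF 2 0 1).out
  have key (M : ZFModel) (a b : M) :
      Sat₂ (φ.relabel ![(inl 0 : Fin 1 ⊕ Fin 1), inr 0]) a b ↔ F M a b := by
    rw [Sat₂, Formula.realize_relabel, hφ]; rfl
  refine ⟨mkHom X Y (φ.relabel ![(inl 0 : Fin 1 ⊕ Fin 1), inr 0]) (fun M a b h => ?_)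
    (fun M a b b' h h' => ?_) (fun M a h => ?_), fun M a b => ?_⟩
  · exact hdom M a b ((key M a b).1 h)
  · rw [key] at h h'
    exact (hfun M a (hdom M a b h).1).unique h h'
  · obtain ⟨b, hb⟩ := (hfun M a h).exists
    exact ⟨b, (key M a b).2 hb⟩
  · rw [holds_mkHom, key]

variable {X Y Z W : DCL}

/-- Inclusion of graphs suffices because the first arrow is total on the common domain and the
second is single-valued. -/
theorem hom_ext_of_imp {f g : X ⟶ Y}
    (h : ∀ (M : ZFModel) (a b : M), Holds f a b → Holds g a b) : f = g :=
  hom_ext fun M a b => ⟨h M a b, fun hg => by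
    obtain ⟨b', hb'⟩ := Holds.exists f hg.dom.1
    rwa [hg.unique (h M a b' hb')]⟩

theorem holds_comp_iff {f : X ⟶ Y} {g : Y ⟶ Z} {M : ZFModel} {a b c : M} (h : Holds f a b) :
    Holds (f ≫ g) a c ↔ Holds g b c := by
  rw [holds_comp]
  exact ⟨fun ⟨b', h1, h2⟩ => by rwa [h.unique h1], fun h' => ⟨b, h, h'⟩⟩

/-- The arrows `p` and `q` identify `Z` with the class of pairs `⟨x, y⟩` such that `P(x, y)`. -/
structure IsGraph (P : ∀ M : ZFModel, M → M → Prop) (p : Z ⟶ X) (q : Z ⟶ Y) : Prop where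
  rel : ∀ {M : ZFModel} {z x y : M}, Holds p z x → Holds q z y → P M x y
  surj : ∀ {M : ZFModel} {x y : M}, Mem X x → Mem Y y → P M x y → ∃ z, Holds p z x ∧ Holds q z y
  inj : ∀ {M : ZFModel} {z z' x y : M}, Holds p z x → Holds q z y → Holds p z' x → Holds q z' y →
    z = z'

theorem exists_isGraph (X Y : DCL) (P : ∀ M : ZFModel, M → M → Prop)
    [hP : ∀ n (i j : Fin n), UDef fun M (v : Fin n → M) => P M (v i) (v j)] :
    ∃ (Z : DCL) (p : Z ⟶ X) (q : Z ⟶ Y), IsGraph P p q := by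
  obtain ⟨Z, hZ⟩ := exists_class fun M z => ∃ x y, IsPair z x y ∧ Mem X x ∧ Mem Y y ∧ P M x y
  obtain ⟨p, hp⟩ := exists_hom Z X
    (fun M z x => Mem X x ∧ ∃ y, IsPair z x y ∧ Mem Y y ∧ P M x y)
    (fun M z x ⟨hx, y, h, hy⟩ => ⟨(hZ M z).2 ⟨x, y, h, hx, hy⟩, hx⟩) fun M z hz => by
      obtain ⟨x, y, h, hx, hy⟩ := (hZ M z).1 hz
      exact ⟨x, ⟨hx, y, h, hy⟩, fun x' ⟨_, y', h', _⟩ => (pair_inj h' h).1⟩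
  obtain ⟨q, hq⟩ := exists_hom Z Y
    (fun M z y => Mem Y y ∧ ∃ x, IsPair z x y ∧ Mem X x ∧ P M x y)
    (fun M z y ⟨hy, x, h, hx, hP⟩ => ⟨(hZ M z).2 ⟨x, y, h, hx, hy, hP⟩, hy⟩) fun M z hz => by
      obtain ⟨x, y, h, hx, hy, hP⟩ := (hZ M z).1 hz
      exact ⟨y, ⟨hy, x, h, hx, hP⟩, fun y' ⟨_, x', h', _⟩ => (pair_inj h' h).2⟩
  refine ⟨Z, p, q, fun {M z x y} h h' => ?_, fun {M x y} hx hy h => ?_,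
    fun {M z z' x y} h1 h2 h3 h4 => ?_⟩
  · obtain ⟨-, y', h1, -, h2⟩ := (hp M z x).1 h
    obtain ⟨-, x', h3, -⟩ := (hq M z y).1 h'
    rwa [(pair_inj h3 h1).2]
  · obtain ⟨z, hz⟩ := pair_exists x y
    exact ⟨z, (hp M z x).2 ⟨hx, y, hz, hy, h⟩, (hq M z y).2 ⟨hy, x, hz, hx, h⟩⟩
  · obtain ⟨-, y1, k1, -⟩ := (hp M z x).1 h1
    obtain ⟨-, x2, k2, -⟩ := (hq M z y).1 h2
    obtain ⟨-, y3, k3, -⟩ := (hp M z' x).1 h3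
    obtain ⟨-, x4, k4, -⟩ := (hq M z' y).1 h4
    obtain ⟨rfl, rfl⟩ := pair_inj k1 k2
    obtain ⟨-, rfl⟩ := pair_inj k3 k4
    exact pair_unique k1 k3

namespace IsGraph

variable {P : ∀ M : ZFModel, M → M → Prop} {p : Z ⟶ X} {q : Z ⟶ Y}

theorem exists_lift (h : IsGraph P p q) (f : W ⟶ X) (g : W ⟶ Y)
    (hfg : ∀ {M : ZFModel} {w x y : M}, Holds f w x → Holds g w y → P M x y) :
    ∃ t : W ⟶ Z, t ≫ p = f ∧ t ≫ q = g := by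
  obtain ⟨t, ht⟩ := exists_hom W Z
    (fun M w z => ∃ x y, Holds f w x ∧ Holds g w y ∧ Holds p z x ∧ Holds q z y)
    (fun M w z ⟨x, y, h1, _, h3, _⟩ => ⟨h1.dom.1, h3.dom.1⟩) fun M w hw => by
      obtain ⟨x, hx⟩ := Holds.exists f hw
      obtain ⟨y, hy⟩ := Holds.exists g hw
      obtain ⟨z, hz, hz'⟩ := h.surj hx.dom.2 hy.dom.2 (hfg hx hy)
      refine ⟨z, ⟨x, y, hx, hy, hz, hz'⟩, fun z' ⟨x', y', hx', hy', h1, h2⟩ => ?_⟩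
      obtain rfl := hx.unique hx'
      obtain rfl := hy.unique hy'
      exact h.inj h1 h2 hz hz'
  refine ⟨t, (hom_ext_of_imp fun M w x hx => ?_).symm, (hom_ext_of_imp fun M w y hy => ?_).symm⟩
  · obtain ⟨z, hz⟩ := Holds.exists t hx.dom.1
    obtain ⟨x', y', h1, h2, h3, h4⟩ := (ht M w z).1 hz
    rwa [holds_comp_iff hz, hx.unique h1]
  · obtain ⟨z, hz⟩ := Holds.exists t hy.dom.1
    obtain ⟨x', y', h1, h2, h3, h4⟩ := (ht M w z).1 hz
    rwa [holds_comp_iff hz, hy.unique h2]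

theorem hom_ext (h : IsGraph P p q) {t t' : W ⟶ Z} (hp : t ≫ p = t' ≫ p) (hq : t ≫ q = t' ≫ q) :
    t = t' :=
  hom_ext_of_imp fun M w z hz => by
    obtain ⟨z', hz'⟩ := Holds.exists t' hz.dom.1
    obtain ⟨x, hx⟩ := Holds.exists p hz.dom.2
    obtain ⟨y, hy⟩ := Holds.exists q hz.dom.2
    have hx' : Holds p z' x := by rwa [← holds_comp_iff hz', ← hp, holds_comp_iff hz]
    have hy' : Holds q z' y := by rwa [← holds_comp_iff hz', ← hq, holds_comp_iff hz]
    rwa [h.inj hx hy hx' hy']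

/-- This gives access to the points of an abstractly chosen limit. Lifting the explicit graph of `P`
shows that all its pairs are attained; joint monicity, tested on the explicit class of pairs of
points with equal coordinates, shows that none is attained twice. -/
theorem of_universal [hP : ∀ n (i j : Fin n), UDef fun M (v : Fin n → M) => P M (v i) (v j)]
    (hrel : ∀ {M : ZFModel} {z x y : M}, Holds p z x → Holds q z y → P M x y)
    (hlift : ∀ (W : DCL) (f : W ⟶ X) (g : W ⟶ Y),
      (∀ {M : ZFModel} {w x y : M}, Holds f w x → Holds g w y → P M x y) →
      ∃ t : W ⟶ Z, t ≫ p = f ∧ t ≫ q = g)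
    (hext : ∀ (W : DCL) (t t' : W ⟶ Z), t ≫ p = t' ≫ p → t ≫ q = t' ≫ q → t = t') :
    IsGraph P p q := by
  refine ⟨hrel, fun {M x y} hx hy hxy => ?_, fun {M z z' x y} h1 h2 h3 h4 => ?_⟩
  · obtain ⟨W, f, g, hW⟩ := exists_isGraph X Y P
    obtain ⟨t, rfl, rfl⟩ := hlift W f g hW.rel
    obtain ⟨w, hw, hw'⟩ := hW.surj hx hy hxy
    obtain ⟨z, hz⟩ := Holds.exists t hw.dom.1
    exact ⟨z, (holds_comp_iff hz).1 hw, (holds_comp_iff hz).1 hw'⟩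
  · obtain ⟨W, f, g, hW⟩ := exists_isGraph Z Z fun M z z' =>
      ∃ x y, Holds p z x ∧ Holds q z y ∧ Holds p z' x ∧ Holds q z' y
    have : f = g := by
      refine hext W f g ?_ ?_
      all_goals
        refine hom_ext_of_imp fun M w a h => ?_
        obtain ⟨z, hz⟩ := Holds.exists f h.dom.1
        obtain ⟨z', hz'⟩ := Holds.exists g h.dom.1
        rw [holds_comp_iff hz] at h
        rw [holds_comp_iff hz']
        obtain ⟨x, y, k1, k2, k3, k4⟩ := hW.rel hz hz'
      · rwa [h.unique k1]
      · rwa [h.unique k2]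
    subst this
    obtain ⟨w, hw, hw'⟩ := hW.surj h1.dom.1 h3.dom.1 ⟨x, y, h1, h2, h3, h4⟩
    exact hw.unique hw'

end IsGraph

/-! ### Monos, products, pullbacks and the terminal object on points -/

theorem mono_iff {f : X ⟶ Y} :
    Mono f ↔ ∀ (M : ZFModel) (a a' b : M), Holds f a b → Holds f a' b → a = a' := by
  constructor
  · intro hf M a a' b h h'
    -- This is the kernel pair of `f`, formed as an explicit class of pairs.
    obtain ⟨W, p, q, hW⟩ := exists_isGraph X X fun M a a' => ∃ b, Holds f a b ∧ Holds f a' b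
    have : p = q := by
      rw [← cancel_mono f]
      refine hom_ext_of_imp fun M w b h => ?_
      obtain ⟨z, hz⟩ := Holds.exists p h.dom.1
      obtain ⟨z', hz'⟩ := Holds.exists q h.dom.1
      rw [holds_comp_iff hz] at h
      rw [holds_comp_iff hz']
      obtain ⟨b', k1, k2⟩ := hW.rel hz hz'
      rwa [h.unique k1]
    subst this
    obtain ⟨w, hw, hw'⟩ := hW.surj h.dom.1 h'.dom.1 ⟨b, h, h'⟩
    exact hw.unique hw'
  · refine fun h => ⟨fun {W} t t' e => hom_ext_of_imp fun M w z hz => ?_⟩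
    obtain ⟨z', hz'⟩ := Holds.exists t' hz.dom.1
    obtain ⟨b, hb⟩ := Holds.exists f hz.dom.2
    have hb' : Holds f z' b := by rwa [← holds_comp_iff hz', ← e, holds_comp_iff hz]
    rwa [h M z z' b hb hb']

theorem isGraph_prod (X Y : DCL) :
    IsGraph (fun _ _ _ => True) (prod.fst : X ⨯ Y ⟶ X) (prod.snd : X ⨯ Y ⟶ Y) :=
  IsGraph.of_universal (fun _ _ => trivial)
    (fun _ f g _ => ⟨prod.lift f g, prod.lift_fst f g, prod.lift_snd f g⟩)
    (fun _ _ _ h h' => Limits.prod.hom_ext h h')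

theorem isGraph_of_isPullback {p : Z ⟶ X} {q : Z ⟶ Y} {f : X ⟶ W} {g : Y ⟶ W}
    (h : IsPullback p q f g) :
    IsGraph (fun _ x y => ∃ c, Holds f x c ∧ Holds g y c) p q := by
  refine IsGraph.of_universal (fun {M z x y} hx hy => ?_) (fun V s t hst => ?_)
    (fun _ _ _ => h.hom_ext)
  · obtain ⟨c, hc⟩ := Holds.exists f hx.dom.2
    refine ⟨c, hc, ?_⟩
    rwa [← holds_comp_iff hy, ← h.w, holds_comp_iff hx]
  · refine ⟨h.lift s t ?_, h.lift_fst _ _ _, h.lift_snd _ _ _⟩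
    refine hom_ext_of_imp fun M v c hc => ?_
    obtain ⟨x, hx⟩ := Holds.exists s hc.dom.1
    obtain ⟨y, hy⟩ := Holds.exists t hc.dom.1
    obtain ⟨c', h1, h2⟩ := hst hx hy
    rw [holds_comp_iff hx] at hc
    rwa [holds_comp_iff hy, hc.unique h1]

theorem IsGraph.isPullback {p : Z ⟶ X} {q : Z ⟶ Y} {f : X ⟶ W} {g : Y ⟶ W}
    (h : IsGraph (fun _ x y => ∃ c, Holds f x c ∧ Holds g y c) p q) : IsPullback p q f g := by
  have lift (s : PullbackCone f g) : ∃ t : s.pt ⟶ Z, t ≫ p = s.fst ∧ t ≫ q = s.snd :=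
    h.exists_lift s.fst s.snd fun {M w x y} hx hy => by
      obtain ⟨c, hc⟩ := Holds.exists f hx.dom.2
      refine ⟨c, hc, ?_⟩
      rwa [← holds_comp_iff hy, ← s.condition, holds_comp_iff hx]
  refine ⟨⟨hom_ext_of_imp fun M z c hc => ?_⟩, ⟨PullbackCone.IsLimit.mk _
    (fun s => (lift s).choose) (fun s => (lift s).choose_spec.1)
    (fun s => (lift s).choose_spec.2) (fun s m h1 h2 => h.hom_ext
      (h1.trans (lift s).choose_spec.1.symm) (h2.trans (lift s).choose_spec.2.symm))⟩⟩
  obtain ⟨x, hx⟩ := Holds.exists p hc.dom.1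
  obtain ⟨y, hy⟩ := Holds.exists q hc.dom.1
  rw [holds_comp_iff hx] at hc
  obtain ⟨c', h1, h2⟩ := h.rel hx hy
  rwa [holds_comp_iff hy, hc.unique h1]

theorem holds_lift_iff {f : W ⟶ X} {g : W ⟶ Y} {M : ZFModel} {w z : M} :
    Holds (prod.lift f g) w z ↔ ∃ x y, Holds f w x ∧ Holds g w y ∧
      Holds (prod.fst : X ⨯ Y ⟶ X) z x ∧ Holds (prod.snd : X ⨯ Y ⟶ Y) z y := by
  have key {z} (h : Holds (prod.lift f g) w z) : ∃ x y, Holds f w x ∧ Holds g w y ∧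
      Holds (prod.fst : X ⨯ Y ⟶ X) z x ∧ Holds (prod.snd : X ⨯ Y ⟶ Y) z y := by
    obtain ⟨x, hx⟩ := Holds.exists (prod.fst : X ⨯ Y ⟶ X) h.dom.2
    obtain ⟨y, hy⟩ := Holds.exists (prod.snd : X ⨯ Y ⟶ Y) h.dom.2
    refine ⟨x, y, ?_, ?_, hx, hy⟩
    · rw [← prod.lift_fst f g, holds_comp_iff h]; exact hx
    · rw [← prod.lift_snd f g, holds_comp_iff h]; exact hy
  refine ⟨key, fun ⟨x, y, h1, h2, h3, h4⟩ => ?_⟩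
  obtain ⟨z', hz'⟩ := Holds.exists (prod.lift f g) h1.dom.1
  obtain ⟨x', y', h1', h2', h3', h4'⟩ := key hz'
  obtain rfl := h1.unique h1'
  obtain rfl := h2.unique h2'
  rwa [(isGraph_prod X Y).inj h3 h4 h3' h4']

/-- Any two arrows into the terminal object agree, in particular the two projections from the class
of all pairs of its points. -/
theorem point_terminal_unique {M : ZFModel} {t t' : M} (h : Mem (⊤_ DCL) t)
    (h' : Mem (⊤_ DCL) t') : t = t' := by
  obtain ⟨W, p, q, hW⟩ := exists_isGraph (⊤_ DCL) (⊤_ DCL) fun _ _ _ => True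
  obtain ⟨w, hw, hw'⟩ := hW.surj h h' trivial
  obtain rfl : p = q := Subsingleton.elim p q
  exact hw.unique hw'

variable {X Y Z : DCL}

/-! ### The universal object and the universe -/

theorem isUniversal_univ : IsUniversal univ := fun X =>
  ⟨incl X univ fun _ a _ => mem_univ a, mono_iff.2 fun M a a' b h h' => by
    rw [holds_incl] at h h'
    exact h.2.trans h'.2.symm⟩

/-- The fibre of the second projection over `y` corresponds bijectively to the set of all `x`
related to `y`, so it is a set by replacement. -/
theorem IsGraph.smallMaps {P : ∀ M : ZFModel, M → M → Prop} {p : Z ⟶ X} {q : Z ⟶ Y}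
    (h : IsGraph P p q)
    (hs : ∀ (M : ZFModel) (y : M), Mem Y y → ∃ a : M, ∀ x, E x a ↔ Mem X x ∧ P M x y) :
    smallMaps q := by
  refine smallMaps_iff.2 fun M y => ?_
  by_cases hy : Mem Y y
  · obtain ⟨a, ha⟩ := hs M y hy
    obtain ⟨b, hb⟩ := model_repl (n := 1) (fun M v x z => Holds p z x ∧ Holds q z (v 0)) ![y] a
      fun x hx => by
        obtain ⟨z, hz⟩ := h.surj ((ha x).1 hx).1 hy ((ha x).1 hx).2
        exact ⟨z, hz, fun z' hz' => h.inj hz'.1 hz'.2 hz.1 hz.2⟩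
    refine ⟨b, fun z => ⟨fun hz => (hb z).2 ?_, fun hz => ?_⟩⟩
    · obtain ⟨x, hx⟩ := Holds.exists p hz.dom.1
      exact ⟨x, (ha x).2 ⟨hx.dom.2, h.rel hx hz⟩, hx, hz⟩
    · obtain ⟨x, -, -, hz⟩ := (hb z).1 hz
      exact hz
  -- Smallness quantifies over all `y` in the model; outside the class `Y` the fibre is empty.
  · obtain ⟨e, he⟩ := model_empty M
    exact ⟨e, fun z => iff_of_false (fun hz => hy hz.dom.2) (he z)⟩

theorem exists_mem_isGraph : ∃ (Z : DCL) (p q : Z ⟶ univ),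
    IsGraph (fun _ x y => E x y) p q ∧ smallMaps q := by
  obtain ⟨Z, p, q, h⟩ := exists_isGraph univ univ fun M x y => E x y
  exact ⟨Z, p, q, h, h.smallMaps fun M y _ => ⟨y, fun x => by simp [mem_univ]⟩⟩

theorem exists_image_of_small {R : DCL} {f : R ⟶ X} {g : R ⟶ Z} (hg : smallMaps g) {M : ZFModel}
    (z : M) : ∃ a : M, ∀ x, E x a ↔ ∃ r, Holds f r x ∧ Holds g r z := by
  obtain ⟨b, hb⟩ := smallMaps_iff.1 hg M z
  obtain ⟨a, ha⟩ := model_repl (n := 0) (fun M _ r x => Holds f r x) ![] b fun r hr => by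
    obtain ⟨x, hx⟩ := Holds.exists f ((hb r).2 hr).dom.1
    exact ⟨x, hx, fun x' hx' => hx'.unique hx⟩
  refine ⟨a, fun x => (ha x).trans (exists_congr fun r => ?_)⟩
  rw [← hb, and_comm]

/-- The object of small subobjects of `V` is `V` itself with the membership relation. A relation
given by `f` and `g`, with `g` small, is classified by `ρ(z) = {f(r) | g(r) = z}`, and the mono into
`V` is the identity. -/
theorem isUniverse_univ : IsUniverse smallMaps univ := by
  obtain ⟨I, p, q, hI, hq⟩ := exists_mem_isGraph
  refine ⟨⟨univ, I, prod.lift p q, ?_, by rwa [prod.lift_snd], fun {Z R} ψ hψ hs => ?_⟩, 𝟙 _,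
    inferInstance⟩
  · refine mono_iff.2 fun M a a' b h h' => ?_
    obtain ⟨x, y, h1, h2, h3, h4⟩ := holds_lift_iff.1 h
    obtain ⟨x', y', h1', h2', h3', h4'⟩ := holds_lift_iff.1 h'
    obtain rfl := h3.unique h3'
    obtain rfl := h4.unique h4'
    exact hI.inj h1 h2 h1' h2'
  obtain ⟨f, hf⟩ : ∃ f, f = ψ ≫ prod.fst := ⟨_, rfl⟩
  obtain ⟨g, hg⟩ : ∃ g, g = ψ ≫ prod.snd := ⟨_, rfl⟩
  have hψfg : ψ = prod.lift f g := by
    rw [hf, hg]; exact Limits.prod.hom_ext (prod.lift_fst _ _).symm (prod.lift_snd _ _).symm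
  rw [← hg] at hs
  clear hf hg
  subst hψfg
  obtain ⟨ρ, hρ⟩ := exists_hom Z univ
    (fun M z a => Mem Z z ∧ ∀ x, E x a ↔ ∃ r, Holds f r x ∧ Holds g r z)
    (fun M z a h => ⟨h.1, mem_univ a⟩) fun M z hz => by
      obtain ⟨a, ha⟩ := exists_image_of_small (f := f) hs z
      exact ⟨a, ⟨hz, ha⟩, fun a' ha' => model_ext fun t => (ha'.2 t).trans (ha t).symm⟩
  have prod_map {M : ZFModel} (τ : Z ⟶ univ) {w v : M} :
      Holds (prod.map (𝟙 univ) τ) w v ↔ ∃ x z a, Holds (prod.fst : univ ⨯ Z ⟶ univ) w x ∧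
        Holds (prod.snd : univ ⨯ Z ⟶ Z) w z ∧ Holds τ z a ∧
        Holds (prod.fst : univ ⨯ univ ⟶ univ) v x ∧ Holds (prod.snd : univ ⨯ univ ⟶ univ) v a := by
    have : prod.map (𝟙 univ) τ = prod.lift prod.fst (prod.snd ≫ τ) :=
      Limits.prod.hom_ext
        (((prod.map_fst _ _).trans (Category.comp_id _)).trans (prod.lift_fst _ _).symm)
        ((prod.map_snd _ _).trans (prod.lift_snd _ _).symm)
    rw [this, holds_lift_iff]
    simp only [holds_comp]
    constructor
    · rintro ⟨x, a, h1, ⟨z, h2, h3⟩, h4, h5⟩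
      exact ⟨x, z, a, h1, h2, h3, h4, h5⟩
    · rintro ⟨x, z, a, h1, h2, h3, h4, h5⟩
      exact ⟨x, a, h1, ⟨z, h2, h3⟩, h4, h5⟩
  obtain ⟨t, ht1, ht2⟩ := hI.exists_lift f (g ≫ ρ) fun {M r x a} hx ha => by
    obtain ⟨z, hz⟩ := Holds.exists g hx.dom.1
    rw [holds_comp_iff hz, hρ] at ha
    exact (ha.2 x).2 ⟨r, hx, hz⟩
  refine ⟨ρ, ⟨t, IsGraph.isPullback ⟨fun {M r m w} hm hw => ?_, fun {M m w} hm hw hmw => ?_,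
    fun {M r r' m w} h1 h2 h3 h4 => mono_iff.1 hψ M r r' w h2 h4⟩⟩, fun ρ' ⟨t', ht'⟩ => ?_⟩
  · obtain ⟨v, hv⟩ := Holds.exists (prod.lift p q) hm.dom.2
    refine ⟨v, hv, ?_⟩
    obtain ⟨x, a, k1, k2, k3, k4⟩ := holds_lift_iff.1 hv
    obtain ⟨x', z, l1, l2, l3, l4⟩ := holds_lift_iff.1 hw
    rw [← holds_comp_iff hm, ht1] at k1
    rw [← holds_comp_iff hm, ht2, holds_comp_iff l2] at k2
    obtain rfl := k1.unique l1
    exact (prod_map ρ).2 ⟨x, z, a, l3, l4, k2, k3, k4⟩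
  · obtain ⟨v, hv, hv'⟩ := hmw
    obtain ⟨x, a, k1, k2, k3, k4⟩ := holds_lift_iff.1 hv
    obtain ⟨x', z, a', l1, l2, l3, l4, l5⟩ := (prod_map ρ).1 hv'
    obtain rfl := k3.unique l4
    obtain rfl := k4.unique l5
    obtain ⟨r, hr, hr'⟩ := (((hρ M z a).1 l3).2 x).1 (hI.rel k1 k2)
    refine ⟨r, ?_, holds_lift_iff.2 ⟨x, z, hr, hr', l1, l2⟩⟩
    obtain ⟨m', hm'⟩ := Holds.exists t hr.dom.1
    have h1 : Holds p m' x := by rwa [← holds_comp_iff hm', ht1]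
    have h2 : Holds q m' a := by rwa [← holds_comp_iff hm', ht2, holds_comp_iff hr']
    rwa [hI.inj k1 k2 h1 h2]
  -- Read on points, the pullback square for `ρ'` says that `x ∈ ρ'(z)` exactly when some `r` lies
  -- over both `x` and `z`. This is the defining property of `ρ(z)`.
  · have hG := isGraph_of_isPullback ht'
    refine hom_ext_of_imp fun M z a ha => (hρ M z a).2 ⟨ha.dom.1, fun x => ⟨fun hx => ?_, ?_⟩⟩
    · obtain ⟨m, hm1, hm2⟩ := hI.surj (mem_univ x) (mem_univ a) hx
      obtain ⟨w, hw1, hw2⟩ := (isGraph_prod univ Z).surj (mem_univ x) ha.dom.1 trivial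
      obtain ⟨v, hv1, hv2⟩ := (isGraph_prod univ univ).surj (mem_univ x) (mem_univ a) trivial
      obtain ⟨r, -, hr⟩ := hG.surj hm1.dom.1 hw1.dom.1
        ⟨v, holds_lift_iff.2 ⟨x, a, hm1, hm2, hv1, hv2⟩,
          (prod_map ρ').2 ⟨x, z, a, hw1, hw2, ha, hv1, hv2⟩⟩
      obtain ⟨x', z', k1, k2, k3, k4⟩ := holds_lift_iff.1 hr
      obtain rfl := k3.unique hw1
      obtain rfl := k4.unique hw2
      exact ⟨r, k1, k2⟩
    · rintro ⟨r, hr1, hr2⟩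
      obtain ⟨m, hm⟩ := Holds.exists t' hr1.dom.1
      obtain ⟨w, hw1, hw2⟩ := (isGraph_prod univ Z).surj hr1.dom.2 hr2.dom.2 trivial
      obtain ⟨v, hv, hv'⟩ := hG.rel hm (holds_lift_iff.2 ⟨x, z, hr1, hr2, hw1, hw2⟩)
      obtain ⟨x', a', k1, k2, k3, k4⟩ := holds_lift_iff.1 hv
      obtain ⟨x'', z', a'', l1, l2, l3, l4, l5⟩ := (prod_map ρ').1 hv'
      obtain rfl := l1.unique hw1
      obtain rfl := l2.unique hw2
      obtain rfl := l3.unique ha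
      obtain rfl := l4.unique k3
      obtain rfl := l5.unique k4
      exact hI.rel k1 k2

end DCL

/-! ### ZF-algebras through their extensions in models -/

open DCL

namespace ZFData

variable {A : ZFData DCL}

/-- The relation of a ZF-algebra on points of models. -/
def LeAt (A : ZFData DCL) {M : ZFModel} (u v : M) : Prop :=
  ∃ r, Holds (A.rel ≫ prod.fst) r u ∧ Holds (A.rel ≫ prod.snd) r v

instance _root_.AST.UDef.leAt {n : ℕ} (i j : Fin n) :
    UDef fun M (v : Fin n → M) => A.LeAt (v i) (v j) := by
  unfold LeAt; infer_instance

theorem isGraph_rel (hA : Mono A.rel) :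
    IsGraph (fun _ u v => A.LeAt u v) (A.rel ≫ prod.fst) (A.rel ≫ prod.snd) where
  rel h h' := ⟨_, h, h'⟩
  surj _ _ h := h
  inj {M r r' x y} h1 h2 h3 h4 := by
    obtain ⟨z, hz⟩ := Holds.exists A.rel h1.dom.1
    obtain ⟨z', hz'⟩ := Holds.exists A.rel h3.dom.1
    rw [holds_comp_iff hz] at h1 h2
    rw [holds_comp_iff hz'] at h3 h4
    obtain rfl := (isGraph_prod _ _).inj h1 h2 h3 h4
    exact mono_iff.1 hA M r r' z hz hz'

theorem le_iff (hA : Mono A.rel) {Z : DCL} {f g : Z ⟶ A.U} :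
    A.Le f g ↔ ∀ {M : ZFModel} {z u v : M}, Holds f z u → Holds g z v → A.LeAt u v := by
  constructor
  · rintro ⟨k, hk⟩ M z u v hu hv
    obtain ⟨r, hr⟩ := Holds.exists k hu.dom.1
    refine ⟨r, ?_, ?_⟩
    · rwa [← holds_comp_iff hr, ← Category.assoc, hk, prod.lift_fst]
    · rwa [← holds_comp_iff hr, ← Category.assoc, hk, prod.lift_snd]
  · intro h
    obtain ⟨k, hk1, hk2⟩ := (isGraph_rel hA).exists_lift f g h
    exact ⟨k, Limits.prod.hom_ext
      (((Category.assoc _ _ _).trans hk1).trans (prod.lift_fst _ _).symm)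
      (((Category.assoc _ _ _).trans hk2).trans (prod.lift_snd _ _).symm)⟩

theorem isBot_iff (hA : Mono A.rel) {b : ⊤_ DCL ⟶ A.U} : A.IsBot b ↔
    ∀ {M : ZFModel} {t c w : M}, Holds b t c → Mem A.U w → A.LeAt c w := by
  constructor
  · intro h M t c w hc hw
    obtain ⟨t', ht'⟩ := Holds.exists (terminal.from A.U) hw
    obtain rfl := point_terminal_unique hc.dom.1 ht'.dom.2
    exact (le_iff hA).1 (h A.U (𝟙 _)) ((holds_comp_iff ht').2 hc) (holds_id.2 ⟨hw, rfl⟩)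
  · intro h Z f
    refine (le_iff hA).2 fun {M z c w} hc hw => ?_
    obtain ⟨t, -, ht⟩ := holds_comp.1 hc
    exact h ht hw.dom.2

/-- From generalized elements to points, each direction applies the definition to the class of pairs
`(p, w)` satisfying the hypothesis of that direction, and evaluates at the given point. The converse
is pointwise evaluation through `le_iff`. -/
theorem isJoin_iff (hA : Mono A.rel) {m : A.U ⨯ A.U ⟶ A.U} : A.IsJoin m ↔
    ∀ {M : ZFModel} {p a b c w : M}, Holds (prod.fst : A.U ⨯ A.U ⟶ A.U) p a →
      Holds (prod.snd : A.U ⨯ A.U ⟶ A.U) p b → Holds m p c → Mem A.U w →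
      (A.LeAt c w ↔ A.LeAt a w ∧ A.LeAt b w) := by
  constructor
  · intro h M p a b c w ha hb hc hw
    constructor
    · intro hcw
      obtain ⟨W, f, g, hW⟩ := exists_isGraph (A.U ⨯ A.U) A.U fun M p w =>
        ∃ c, Holds m p c ∧ A.LeAt c w
      have := (h W (f ≫ prod.fst) (f ≫ prod.snd) g).1 ((le_iff hA).2 fun {M z c w} hc hw => by
        rw [← prod.comp_lift, prod.lift_fst_snd, Category.comp_id] at hc
        obtain ⟨p, hp, hc⟩ := holds_comp.1 hc
        obtain ⟨c', hc', hcw⟩ := hW.rel hp hw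
        rwa [hc.unique hc'])
      obtain ⟨z, hz, hz'⟩ := hW.surj hc.dom.1 hw ⟨c, hc, hcw⟩
      exact ⟨(le_iff hA).1 this.1 ((holds_comp_iff hz).2 ha) hz',
        (le_iff hA).1 this.2 ((holds_comp_iff hz).2 hb) hz'⟩
    · intro hab
      obtain ⟨W, f, g, hW⟩ := exists_isGraph (A.U ⨯ A.U) A.U fun M p w =>
        ∃ a b, Holds (prod.fst : A.U ⨯ A.U ⟶ A.U) p a ∧
          Holds (prod.snd : A.U ⨯ A.U ⟶ A.U) p b ∧ A.LeAt a w ∧ A.LeAt b w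
      have := (h W (f ≫ prod.fst) (f ≫ prod.snd) g).2 ⟨(le_iff hA).2 fun {M z a w} ha hw => by
        obtain ⟨p, hp, ha⟩ := holds_comp.1 ha
        obtain ⟨a', b', ha', hb', h1, h2⟩ := hW.rel hp hw
        rwa [ha.unique ha'], (le_iff hA).2 fun {M z a w} ha hw => by
        obtain ⟨p, hp, ha⟩ := holds_comp.1 ha
        obtain ⟨a', b', ha', hb', h1, h2⟩ := hW.rel hp hw
        rwa [ha.unique hb']⟩
      rw [← prod.comp_lift, prod.lift_fst_snd, Category.comp_id] at this
      obtain ⟨z, hz, hz'⟩ := hW.surj hc.dom.1 hw ⟨a, b, ha, hb, hab⟩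
      exact (le_iff hA).1 this ((holds_comp_iff hz).2 hc) hz'
  · intro h Z f g l
    rw [le_iff hA, le_iff hA, le_iff hA]
    constructor
    · intro H
      refine ⟨fun {M z a w} ha hw => ?_, fun {M z b w} hb hw => ?_⟩
      · obtain ⟨b, hb⟩ := Holds.exists g ha.dom.1
        obtain ⟨p, hp1, hp2⟩ := (isGraph_prod A.U A.U).surj ha.dom.2 hb.dom.2 trivial
        obtain ⟨c, hc⟩ := Holds.exists m hp1.dom.1
        exact ((h hp1 hp2 hc hw.dom.2).1 (H ((holds_comp_iff
          (holds_lift_iff.2 ⟨a, b, ha, hb, hp1, hp2⟩)).2 hc) hw)).1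
      · obtain ⟨a, ha⟩ := Holds.exists f hb.dom.1
        obtain ⟨p, hp1, hp2⟩ := (isGraph_prod A.U A.U).surj ha.dom.2 hb.dom.2 trivial
        obtain ⟨c, hc⟩ := Holds.exists m hp1.dom.1
        exact ((h hp1 hp2 hc hw.dom.2).1 (H ((holds_comp_iff
          (holds_lift_iff.2 ⟨a, b, ha, hb, hp1, hp2⟩)).2 hc) hw)).2
    · rintro ⟨H1, H2⟩ M z c w hc hw
      obtain ⟨p, hp, hc⟩ := holds_comp.1 hc
      obtain ⟨a, b, ha, hb, hp1, hp2⟩ := holds_lift_iff.1 hp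
      exact (h hp1 hp2 hc hw.dom.2).2 ⟨H1 ha hw, H2 hb hw⟩

/-- As for joins, the generic stages are classes of pairs `(d, w)`: those with `s(d) ≤ w`, and those
for which `w` bounds `l` on the fibre of `j` over `d`. Points of the pullback are pairs of a stage
point and an element of the fibre. -/
theorem isSup_iff (hA : Mono A.rel) {B D : DCL} {j : B ⟶ D} {l : B ⟶ A.U} {s : D ⟶ A.U} :
    A.IsSup j l s ↔ ∀ {M : ZFModel} {d c w : M}, Holds s d c → Mem A.U w →
      (A.LeAt c w ↔ ∀ b u, Holds j b d → Holds l b u → A.LeAt u w) := by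
  have pb {W : DCL} (f : W ⟶ D) := isGraph_of_isPullback (IsPullback.of_hasPullback f j)
  constructor
  · intro h M d c w hc hw
    constructor
    · intro hcw b u hb hu
      obtain ⟨W, f, g, hW⟩ := exists_isGraph D A.U fun M d w => ∃ c, Holds s d c ∧ A.LeAt c w
      have := (h W f g).1 ((le_iff hA).2 fun {M z c w} hc hw => by
        obtain ⟨d, hd, hc⟩ := holds_comp.1 hc
        obtain ⟨c', hc', hcw⟩ := hW.rel hd hw
        rwa [hc.unique hc'])
      obtain ⟨z, hz, hz'⟩ := hW.surj hc.dom.1 hw ⟨c, hc, hcw⟩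
      obtain ⟨x, hx, hx'⟩ := (pb f).surj hz.dom.1 hb.dom.1 ⟨d, hz, hb⟩
      exact (le_iff hA).1 this ((holds_comp_iff hx').2 hu) ((holds_comp_iff hx).2 hz')
    · intro H
      obtain ⟨W, f, g, hW⟩ := exists_isGraph D A.U fun M d w =>
        ∀ b u, Holds j b d → Holds l b u → A.LeAt u w
      have := (h W f g).2 ((le_iff hA).2 fun {M x u w} hu hw => by
        obtain ⟨b, hb, hu⟩ := holds_comp.1 hu
        obtain ⟨z, hz, hw⟩ := holds_comp.1 hw
        obtain ⟨d, hd, hbd⟩ := (pb f).rel hz hb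
        exact hW.rel hd hw b u hbd hu)
      obtain ⟨z, hz, hz'⟩ := hW.surj hc.dom.1 hw H
      exact (le_iff hA).1 this ((holds_comp_iff hz).2 hc) hz'
  · intro h W f g
    rw [le_iff hA, le_iff hA]
    constructor
    · intro H M x u w hu hw
      obtain ⟨b, hb, hu⟩ := holds_comp.1 hu
      obtain ⟨z, hz, hw⟩ := holds_comp.1 hw
      obtain ⟨d, hd, hbd⟩ := (pb f).rel hz hb
      obtain ⟨c, hc⟩ := Holds.exists s hd.dom.2
      exact (h hc hw.dom.2).1 (H ((holds_comp_iff hd).2 hc) hw) b u hbd hu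
    · intro H M z c w hc hw
      obtain ⟨d, hd, hc⟩ := holds_comp.1 hc
      refine (h hc hw.dom.2).2 fun b u hb hu => ?_
      obtain ⟨x, hx, hx'⟩ := (pb f).surj hd.dom.1 hb.dom.1 ⟨d, hd, hb⟩
      exact H ((holds_comp_iff hx').2 hu) ((holds_comp_iff hx).2 hw)

end ZFData

/-! ### The order of a ZF-algebra on points -/

namespace IsZFAlgebra

variable {A : ZFData DCL} (hA : IsZFAlgebra smallMaps A)
include hA

theorem leAt_refl {M : ZFModel} {u : M} (hu : Mem A.U u) : A.LeAt u u :=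
  (ZFData.le_iff hA.mono_rel).1 (hA.le_refl (𝟙 A.U)) (holds_id.2 ⟨hu, rfl⟩) (holds_id.2 ⟨hu, rfl⟩)

theorem leAt_antisymm {M : ZFModel} {u v : M} (hu : Mem A.U u) (hv : Mem A.U v)
    (h : A.LeAt u v) (h' : A.LeAt v u) : u = v := by
  obtain ⟨W, p, q, hW⟩ := exists_isGraph A.U A.U fun M u v => A.LeAt u v ∧ A.LeAt v u
  obtain rfl : p = q := hA.le_antisymm p q
    ((ZFData.le_iff hA.mono_rel).2 fun hu hv => (hW.rel hu hv).1)
    ((ZFData.le_iff hA.mono_rel).2 fun hv hu => (hW.rel hu hv).2)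
  obtain ⟨w, hw, hw'⟩ := hW.surj hu hv ⟨h, h'⟩
  exact hw.unique hw'

theorem eq_of_forall_leAt_iff {M : ZFModel} {u v : M} (hu : Mem A.U u) (hv : Mem A.U v)
    (h : ∀ w, Mem A.U w → (A.LeAt u w ↔ A.LeAt v w)) : u = v :=
  hA.leAt_antisymm hu hv ((h v hv).2 (hA.leAt_refl hv)) ((h u hu).1 (hA.leAt_refl hu))

/-- The arrow `d ↦ sup {σ(u) | u ∈ d}` on sets of elements of a ZF-algebra. -/
theorem exists_sup_set : ∃ (D : DCL) (s : D ⟶ A.U),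
    (∀ (M : ZFModel) (d : M), Mem D d ↔ ∀ u, E u d → Mem A.U u) ∧
    ∀ {M : ZFModel} {d c w : M}, Holds s d c → Mem A.U w →
      (A.LeAt c w ↔ ∀ u u', E u d → Holds A.σ u u' → A.LeAt u' w) := by
  obtain ⟨D, hD⟩ := exists_class fun M d => ∀ u, E u d → Mem A.U u
  obtain ⟨W, p, q, hW⟩ := exists_isGraph A.U D fun M u d => E u d
  -- Membership of elements of `U` in sets of such elements is small over `D`, the fibre over `d`
  -- being `d` itself, so the algebra has suprema along it.
  obtain ⟨s, hs⟩ := hA.exists_sup q (hW.smallMaps fun M d hd => ⟨d, fun u =>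
    ⟨fun h => ⟨(hD M d).1 hd u h, h⟩, fun h => h.2⟩⟩) (p ≫ A.σ)
  refine ⟨D, s, hD, fun {M d c w} hc hw => ?_⟩
  rw [(ZFData.isSup_iff hA.mono_rel).1 hs hc hw]
  constructor
  · intro H u u' hu hu'
    obtain ⟨z, hz, hz'⟩ := hW.surj hu'.dom.1 hc.dom.1 hu
    exact H z u' hz' ((holds_comp_iff hz).2 hu')
  · intro H b u hb hu
    obtain ⟨v, hv, hu⟩ := holds_comp.1 hu
    exact H v u (hW.rel hv hb) hu

end IsZFAlgebra

/-- The arrow `h : V ⟶ U` satisfies `h(x) = sup {σ(h(y)) | y ∈ x}`. -/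
def IsFold (A : ZFData DCL) (h : univ ⟶ A.U) : Prop :=
  ∀ {M : ZFModel} {x c w : M}, Holds h x c → Mem A.U w →
    (A.LeAt c w ↔ ∀ y u u', E y x → Holds h y u → Holds A.σ u u' → A.LeAt u' w)

/-! ### Existence and uniqueness of the fold -/

namespace IsZFAlgebra

variable {A : ZFData DCL} (hA : IsZFAlgebra smallMaps A)
include hA

/-- By ∈-induction: if two folds agree on the members of `x`, their values at `x` have the same
upper bounds and therefore coincide. -/
theorem isFold_unique {h k : univ ⟶ A.U} (hh : IsFold A h) (hk : IsFold A k) : h = k := by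
  have key (M : ZFModel) (x : M) : ∀ u v, Holds h x u → Holds k x v → u = v := by
    refine mem_induction (n := 0) (fun M _ x => ∀ u v, Holds h x u → Holds k x v → u = v) ![]
      (fun x ih u v hu hv => ?_) x
    refine hA.eq_of_forall_leAt_iff hu.dom.2 hv.dom.2 fun w hw => ?_
    rw [hh hu hw, hk hv hw]
    refine forall_congr' fun y => ⟨fun H a a' hy ha => ?_, fun H a a' hy ha => ?_⟩
    · obtain ⟨b, hb⟩ := Holds.exists h (mem_univ y)
      obtain rfl := ih y hy b a hb ha
      exact H b a' hy hb
    · obtain ⟨b, hb⟩ := Holds.exists k (mem_univ y)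
      obtain rfl := ih y hy a b ha hb
      exact H a a' hy hb
  refine hom_ext_of_imp fun M x u hu => ?_
  obtain ⟨v, hv⟩ := Holds.exists k (mem_univ x)
  rwa [key M x u v hu hv]

theorem exists_isFold : ∃ h : univ ⟶ A.U, IsFold A h := by
  obtain ⟨D, s, hD, hs⟩ := hA.exists_sup_set
  -- Recursion needs a function defined on all sets. Where `d` is not a set of elements of `U` the
  -- default value is `d` itself; this case never occurs in the recursion. Since `G` ignores its
  -- parameter, `x` can serve as one, and `RecRel G x y` unfolds to the same relation as `RecRel G y
  -- y`.
  let G : ∀ M : ZFModel, M → M → M → Prop := fun M _ d w => Holds s d w ∨ (¬ Mem D d ∧ w = d)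
  have hG : ∀ n (i j k : Fin n), UDef fun M (v : Fin n → M) => G M (v i) (v j) (v k) :=
    fun n i j k => by dsimp only [G]; infer_instance
  have hfun {M : ZFModel} (p d : M) : ∃! w, G M p d w := by
    by_cases hd : Mem D d
    · obtain ⟨w, hw⟩ := Holds.exists s hd
      exact ⟨w, .inl hw, fun w' hw' => (hw'.resolve_right fun h => h.1 hd).unique hw⟩
    · exact ⟨d, .inr ⟨hd, rfl⟩, fun w' hw' => (hw'.resolve_left fun h => hd h.dom.1).2⟩
  -- By induction all values lie in `U`, so the image of `x` belongs to `D` and the default branch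
  -- is excluded.
  have hmem {M : ZFModel} (x : M) : ∀ w, RecRel G x x w → Mem A.U w := by
    refine mem_induction (n := 0) (fun M _ x => ∀ w, RecRel G x x w → Mem A.U w) ![]
      (fun x ih w hw => ?_) x
    obtain ⟨d, hd, hdw⟩ := hw.image (hfun x)
    have : Mem D d := (hD M d).2 fun u hu => by
      obtain ⟨y, hy, hyu⟩ := (hd u).1 hu
      exact ih y hy u hyu
    exact (hdw.resolve_right fun h => h.1 this).dom.2
  obtain ⟨h, hh⟩ := exists_hom univ A.U (fun M x w => RecRel G x x w)
    (fun M x w hw => ⟨mem_univ x, hmem x w hw⟩) fun M x _ => mem_recursion (hfun x) x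
  refine ⟨h, fun {M x c w} hc hw => ?_⟩
  obtain ⟨d, hd, hdc⟩ := ((hh M x c).1 hc).image (hfun x)
  replace hd : ∀ t, E t d ↔ ∃ y, E y x ∧ Holds h y t := fun t =>
    (hd t).trans (exists_congr fun y => and_congr_right fun _ => (hh M y t).symm)
  have : Mem D d := (hD M d).2 fun u hu => by
    obtain ⟨y, -, hyu⟩ := (hd u).1 hu
    exact hyu.dom.2
  rw [hs (hdc.resolve_right fun h => h.1 this) hw]
  constructor
  · exact fun H y u u' hy hu hu' => H u u' ((hd u).2 ⟨y, hy, hu⟩) hu'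
  · intro H u u' hu hu'
    obtain ⟨y, hy, hyu⟩ := (hd u).1 hu
    exact H y u u' hy hyu hu'

end IsZFAlgebra

namespace DCL

/-! ### The algebra of all sets -/

theorem holds_subsetFst {M : ZFModel} {z x : M} :
    Holds subsetFst z x ↔ ∃ y, IsPair z x y ∧ ∀ t, E t x → E t y := by
  rw [subsetFst, holds_mkHom, sat₂_iff]
  simp [Fin.snoc]

theorem holds_subsetSnd {M : ZFModel} {z y : M} :
    Holds subsetSnd z y ↔ ∃ x, IsPair z x y ∧ ∀ t, E t x → E t y := by
  rw [subsetSnd, holds_mkHom, sat₂_iff]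
  simp [Fin.snoc]

theorem holds_singleton {M : ZFModel} {x z : M} :
    Holds singleton x z ↔ ∀ t, E t z ↔ t = x := by
  rw [singleton, holds_mkHom, sat₂_iff, realize_inst, comp_two]
  simp [isSingletonF, Formula.Realize, Fin.snoc]

theorem sat₂_unionF {Q : LSet.Formula (Fin 1)} {F L : LSet.Formula (Fin 1 ⊕ Fin 1)}
    {M : ZFModel} {a x : M} : Sat₂ (unionF Q F L) a x ↔ Sat Q a ∧
      ∀ t, E t x ↔ ∃ z s, Sat₂ F z a ∧ Sat₂ L z s ∧ E t s := by
  rw [sat₂_iff]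
  simp [unionF, Fin.snoc, and_assoc]

theorem setAlgebra_leAt {M : ZFModel} {u v : M} :
    setAlgebra.LeAt u v ↔ ∀ t, E t u → E t v := by
  rw [ZFData.LeAt]
  change (∃ r, Holds (prod.lift subsetFst subsetSnd ≫ prod.fst) r u ∧
    Holds (prod.lift subsetFst subsetSnd ≫ prod.snd) r v) ↔ _
  rw [prod.lift_fst, prod.lift_snd]
  simp only [holds_subsetFst, holds_subsetSnd]
  constructor
  · rintro ⟨r, ⟨y, h, hy⟩, x, h', -⟩
    rwa [← (pair_inj h h').2]
  · intro h
    obtain ⟨r, hr⟩ := pair_exists u v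
    exact ⟨r, ⟨v, hr, h⟩, u, hr, h⟩

theorem setAlgebra_mono_rel : Mono setAlgebra.rel := by
  refine mono_iff.2 fun M r r' b h h' => ?_
  obtain ⟨x, y, h1, h2, h3, h4⟩ := holds_lift_iff.1 h
  obtain ⟨x', y', h1', h2', h3', h4'⟩ := holds_lift_iff.1 h'
  obtain rfl := h3.unique h3'
  obtain rfl := h4.unique h4'
  obtain ⟨y1, k1, -⟩ := holds_subsetFst.1 h1
  obtain ⟨x1, k2, -⟩ := holds_subsetSnd.1 h2
  obtain ⟨y2, k3, -⟩ := holds_subsetFst.1 h1'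
  obtain ⟨x2, k4, -⟩ := holds_subsetSnd.1 h2'
  obtain ⟨rfl, rfl⟩ := pair_inj k1 k2
  obtain ⟨-, rfl⟩ := pair_inj k3 k4
  exact pair_unique k1 k3

/-- No smallness of `j` is needed: once a supremum exists, separation inside it suffices to compare
it with the union. -/
theorem setAlgebra_isSup_iff {B D : DCL} {j : B ⟶ D} {l : B ⟶ univ} {s : D ⟶ univ} :
    setAlgebra.IsSup j l s ↔ ∀ (M : ZFModel) (d c : M), Holds s d c →
      ∀ t, E t c ↔ ∃ b u, Holds j b d ∧ Holds l b u ∧ E t u := by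
  rw [ZFData.isSup_iff setAlgebra_mono_rel]
  simp only [setAlgebra_leAt]
  constructor
  · intro h M d c hc t
    constructor
    · intro ht
      -- `w` consists of those elements of `c` that belong to some `l(b)` with `b` over `d`. It is
      -- still an upper bound, so the least upper bound `c` is contained in it.
      obtain ⟨w, hw⟩ := model_sep (n := 1) (fun M v t =>
        ∃ b u, Holds j b (v 0) ∧ Holds l b u ∧ E t u) ![d] c
      refine ((hw t).1 ((h hc (mem_univ w)).2 (fun b u hb hu t ht => (hw t).2 ?_) t ht)).2
      exact ⟨(h hc (mem_univ c)).1 (fun _ h => h) b u hb hu t ht, b, u, hb, hu, ht⟩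
    · rintro ⟨b, u, hb, hu, ht⟩
      exact (h hc (mem_univ c)).1 (fun _ h => h) b u hb hu t ht
  · intro h M d c w hc _
    constructor
    · exact fun H b u hb hu t ht => H t ((h M d c hc t).2 ⟨b, u, hb, hu, ht⟩)
    · intro H t ht
      obtain ⟨b, u, hb, hu, ht⟩ := (h M d c hc t).1 ht
      exact H b u hb hu t ht

/-- Suprema of sets are given by unions. -/
theorem exists_isSup_union {X Y : DCL} (F : ClassFun X Y) (L : ClassFun X univ)
    (hF : smallMaps (arrow F)) : ∃ G : ClassFun Y univ,
      G.toFormula = unionF (DefClass.formula Y) F.toFormula L.toFormula ∧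
      setAlgebra.IsSup (arrow F) (arrow L) (arrow G) := by
  refine ⟨ClassFun.ofModels Y univ (unionF (DefClass.formula Y) F.toFormula L.toFormula)
    (fun M a b h => ⟨(sat₂_unionF.1 h).1, mem_univ b⟩)
    (fun M a b b' h h' => model_ext fun t =>
      ((sat₂_unionF.1 h).2 t).trans ((sat₂_unionF.1 h').2 t).symm)
    (fun M a ha => ?_), rfl, setAlgebra_isSup_iff.2 fun M d c hc t => ?_⟩
  · obtain ⟨i, hi⟩ := exists_image_of_small (f := arrow L) hF a
    obtain ⟨c, hc⟩ := model_union i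
    refine ⟨c, sat₂_unionF.2 ⟨ha, fun t => (hc t).trans ?_⟩⟩
    simp only [hi, holds_arrow]
    constructor
    · rintro ⟨s, ht, z, hs, hz⟩
      exact ⟨z, s, hz, hs, ht⟩
    · rintro ⟨z, s, hz, hs, ht⟩
      exact ⟨s, ht, z, hs, hz⟩
  · simp only [holds_arrow]
    exact (sat₂_unionF.1 ((holds_arrow _ _ _).1 hc)).2 t

theorem isZFAlgebra_setAlgebra : IsZFAlgebra smallMaps setAlgebra where
  mono_rel := setAlgebra_mono_rel
  le_refl f := (ZFData.le_iff setAlgebra_mono_rel).2 fun {M z u v} hu hv => by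
    obtain rfl := hu.unique hv
    exact setAlgebra_leAt.2 fun _ h => h
  le_trans f g h hfg hgh := (ZFData.le_iff setAlgebra_mono_rel).2 fun {M z u w} hu hw => by
    obtain ⟨v, hv⟩ := Holds.exists g hu.dom.1
    exact setAlgebra_leAt.2 fun t ht =>
      setAlgebra_leAt.1 ((ZFData.le_iff setAlgebra_mono_rel).1 hgh hv hw) t
        (setAlgebra_leAt.1 ((ZFData.le_iff setAlgebra_mono_rel).1 hfg hu hv) t ht)
  le_antisymm f g hfg hgf := hom_ext_of_imp fun M z u hu => by
    obtain ⟨v, hv⟩ := Holds.exists g hu.dom.1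
    have : u = v := model_ext fun t =>
      ⟨setAlgebra_leAt.1 ((ZFData.le_iff setAlgebra_mono_rel).1 hfg hu hv) t,
        setAlgebra_leAt.1 ((ZFData.le_iff setAlgebra_mono_rel).1 hgf hv hu) t⟩
    rwa [this]
  exists_bot := by
    obtain ⟨b, hb⟩ := exists_hom (⊤_ DCL) univ (fun M t c => Mem (⊤_ DCL) t ∧ ∀ u, ¬ E u c)
      (fun M t c h => ⟨h.1, mem_univ c⟩) fun M t ht => by
        obtain ⟨c, hc⟩ := model_empty M
        exact ⟨c, ⟨ht, hc⟩, fun c' hc' => model_ext fun u => iff_of_false (hc'.2 u) (hc u)⟩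
    exact ⟨b, (ZFData.isBot_iff setAlgebra_mono_rel).2 fun {M t c w} hc _ =>
      setAlgebra_leAt.2 fun u hu => absurd hu (((hb M t c).1 hc).2 u)⟩
  exists_join := by
    obtain ⟨m, hm⟩ := exists_hom (univ ⨯ univ) univ (fun M p c => ∃ a b,
        Holds (prod.fst : univ ⨯ univ ⟶ univ) p a ∧ Holds (prod.snd : univ ⨯ univ ⟶ univ) p b ∧
          ∀ t, E t c ↔ E t a ∨ E t b)
      (fun M p c ⟨a, b, h, _⟩ => ⟨h.dom.1, mem_univ c⟩) fun M p hp => by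
        obtain ⟨a, ha⟩ := Holds.exists (prod.fst : univ ⨯ univ ⟶ univ) hp
        obtain ⟨b, hb⟩ := Holds.exists (prod.snd : univ ⨯ univ ⟶ univ) hp
        obtain ⟨c, hc⟩ := model_union₂ a b
        refine ⟨c, ⟨a, b, ha, hb, hc⟩, fun c' ⟨a', b', ha', hb', hc'⟩ => ?_⟩
        obtain rfl := ha.unique ha'
        obtain rfl := hb.unique hb'
        exact model_ext fun t => (hc' t).trans (hc t).symm
    refine ⟨m, (ZFData.isJoin_iff setAlgebra_mono_rel).2 fun {M p a b c w} ha hb hc _ => ?_⟩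
    obtain ⟨a', b', ha', hb', hc⟩ := (hm M p c).1 hc
    obtain rfl := ha.unique ha'
    obtain rfl := hb.unique hb'
    simp only [setAlgebra_leAt, hc]
    exact ⟨fun h => ⟨fun t ht => h t (.inl ht), fun t ht => h t (.inr ht)⟩,
      fun h t ht => ht.elim (h.1 t) (h.2 t)⟩
  exists_sup {B D} j hj l := by
    rw [← arrow_out j] at hj ⊢
    obtain ⟨G, -, hG⟩ := exists_isSup_union _ (Quotient.out l.hom) hj
    rw [arrow_out l] at hG
    exact ⟨_, hG⟩

theorem setAlgebra_isJoin {m : univ ⨯ univ ⟶ univ} (hm : setAlgebra.IsJoin m) {M : ZFModel}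
    {p a b c : M} (ha : Holds (prod.fst : univ ⨯ univ ⟶ univ) p a)
    (hb : Holds (prod.snd : univ ⨯ univ ⟶ univ) p b) (hc : Holds m p c) (t : M) :
    E t c ↔ E t a ∨ E t b := by
  have h {w} := (ZFData.isJoin_iff setAlgebra_mono_rel).1 hm ha hb hc (mem_univ w)
  simp only [setAlgebra_leAt] at h
  constructor
  · obtain ⟨w, hw⟩ := model_union₂ a b
    exact fun ht => (hw t).1 (h.2 ⟨fun t ht => (hw t).2 (.inl ht),
      fun t ht => (hw t).2 (.inr ht)⟩ t ht)
  · obtain ⟨h1, h2⟩ := h.1 fun t ht => ht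
    exact fun ht => ht.elim (h1 t) (h2 t)

end DCL

open DCL

/-! ### The fold as the unique morphism -/

namespace IsFold

variable {A : ZFData DCL} {h : univ ⟶ A.U}

theorem leAt_of_mem (hA : IsZFAlgebra smallMaps A) (hh : IsFold A h) {M : ZFModel}
    {x y c u u' : M} (hc : Holds h x c) (hy : E y x) (hu : Holds h y u) (hu' : Holds A.σ u u') :
    A.LeAt u' c :=
  (hh hc hc.dom.2).1 (hA.leAt_refl hc.dom.2) y u u' hy hu hu'

theorem map_le (hA : IsZFAlgebra smallMaps A) (hh : IsFold A h) {Z : DCL} (f g : Z ⟶ univ)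
    (hfg : setAlgebra.Le f g) : A.Le (f ≫ h) (g ≫ h) := by
  refine (ZFData.le_iff hA.mono_rel).2 fun {M z c d} hc hd => ?_
  obtain ⟨x, hx, hc⟩ := holds_comp.1 hc
  obtain ⟨y, hy, hd⟩ := holds_comp.1 hd
  have hxy := setAlgebra_leAt.1 ((ZFData.le_iff setAlgebra_mono_rel).1 hfg hx hy)
  exact (hh hc hd.dom.2).2 fun t u u' ht hu hu' => hh.leAt_of_mem hA hd (hxy t ht) hu hu'

theorem map_bot (hA : IsZFAlgebra smallMaps A) (hh : IsFold A h) (b : ⊤_ DCL ⟶ univ)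
    (hb : setAlgebra.IsBot b) : A.IsBot (b ≫ h) := by
  refine (ZFData.isBot_iff hA.mono_rel).2 fun {M t c w} hc hw => ?_
  obtain ⟨x, hx, hc⟩ := holds_comp.1 hc
  obtain ⟨e, he⟩ := model_empty M
  have hxe := setAlgebra_leAt.1
    ((ZFData.isBot_iff setAlgebra_mono_rel).1 hb hx (mem_univ e))
  exact (hh hc hw).2 fun y _ _ hy => absurd (hxe y hy) (he y)

/-- The members of a binary union are those of the two sets, so the value at the union and the join
of the two values have the same upper bounds. -/
theorem map_join (hA : IsZFAlgebra smallMaps A) (hh : IsFold A h) (m : univ ⨯ univ ⟶ univ)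
    (m' : A.U ⨯ A.U ⟶ A.U) (hm : setAlgebra.IsJoin m) (hm' : A.IsJoin m') :
    m ≫ h = prod.map h h ≫ m' := by
  refine hom_ext_of_imp fun M p c hc => ?_
  obtain ⟨x, hx, hc⟩ := holds_comp.1 hc
  obtain ⟨a, ha⟩ := Holds.exists (prod.fst : univ ⨯ univ ⟶ univ) hx.dom.1
  obtain ⟨b, hb⟩ := Holds.exists (prod.snd : univ ⨯ univ ⟶ univ) hx.dom.1
  obtain ⟨a', ha'⟩ := Holds.exists h (mem_univ a)
  obtain ⟨b', hb'⟩ := Holds.exists h (mem_univ b)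
  obtain ⟨q, hq⟩ := Holds.exists (prod.map h h) hx.dom.1
  obtain ⟨d, hd⟩ := Holds.exists m' hq.dom.2
  have hqa : Holds (prod.fst : A.U ⨯ A.U ⟶ A.U) q a' := by
    rw [← holds_comp_iff hq, prod.map_fst, holds_comp_iff ha]; exact ha'
  have hqb : Holds (prod.snd : A.U ⨯ A.U ⟶ A.U) q b' := by
    rw [← holds_comp_iff hq, prod.map_snd, holds_comp_iff hb]; exact hb'
  rw [holds_comp_iff hq]
  have key : c = d := hA.eq_of_forall_leAt_iff hc.dom.2 hd.dom.2 fun w hw => by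
    rw [(ZFData.isJoin_iff hA.mono_rel).1 hm' hqa hqb hd hw, hh hc hw, hh ha' hw, hh hb' hw]
    have hx := setAlgebra_isJoin hm ha hb hx
    exact ⟨fun H => ⟨fun y u u' hy => H y u u' ((hx y).2 (.inl hy)),
      fun y u u' hy => H y u u' ((hx y).2 (.inr hy))⟩,
      fun H y u u' hy => ((hx y).1 hy).elim (H.1 y u u') (H.2 y u u')⟩
  rwa [key]

/-- Bounding the fold at a union means bounding `σ(h(y))` for each `y` in some `l(b)`, which is the
same as bounding the fold at every `l(b)`. -/
theorem map_sup (hA : IsZFAlgebra smallMaps A) (hh : IsFold A h) {X D : DCL} (j : X ⟶ D)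
    (l : X ⟶ univ) (s : D ⟶ univ) (hs : setAlgebra.IsSup j l s) :
    A.IsSup j (l ≫ h) (s ≫ h) := by
  refine (ZFData.isSup_iff hA.mono_rel).2 fun {M d c w} hc hw => ?_
  obtain ⟨x, hx, hc⟩ := holds_comp.1 hc
  have hs := setAlgebra_isSup_iff.1 hs M d x hx
  rw [hh hc hw]
  constructor
  · intro H b u hb hu
    obtain ⟨z, hz, hu⟩ := holds_comp.1 hu
    exact (hh hu hw).2 fun y v v' hy => H y v v' ((hs y).2 ⟨b, z, hb, hz, hy⟩)
  · intro H y v v' hy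
    obtain ⟨b, z, hb, hz, hy⟩ := (hs y).1 hy
    obtain ⟨u, hu⟩ := Holds.exists h (mem_univ z)
    exact (hh hu hw).1 (H b u hb ((holds_comp_iff hz).2 hu)) y v v' hy

/-- The supremum defining the value at `{x}` ranges over the single element `σ(h(x))`. -/
theorem map_σ (hA : IsZFAlgebra smallMaps A) (hh : IsFold A h) : singleton ≫ h = h ≫ A.σ := by
  refine hom_ext_of_imp fun M x c hc => ?_
  obtain ⟨z, hz, hc⟩ := holds_comp.1 hc
  obtain ⟨u, hu⟩ := Holds.exists h (mem_univ x)
  obtain ⟨u', hu'⟩ := Holds.exists A.σ hu.dom.2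
  rw [holds_singleton] at hz
  rw [holds_comp_iff hu]
  have key : c = u' := hA.eq_of_forall_leAt_iff hc.dom.2 hu'.dom.2 fun w hw => by
    rw [hh hc hw]
    refine ⟨fun H => H x u u' ((hz x).2 rfl) hu hu', fun H y v v' hy hv hv' => ?_⟩
    obtain rfl := (hz y).1 hy
    obtain rfl := hu.unique hv
    rwa [hv'.unique hu']
  rwa [key]

end IsFold

/-- Every set is the union of the singletons of its members: the identity of `V` is the supremum,
along the small projection of the membership relation, of the singleton map. A morphism preserves
this supremum and commutes with `σ`, which gives the fold equation. -/
theorem ZFAlgebra.Hom.isFold {A : ZFAlgebra smallMaps}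
    (φ : ZFAlgebra.Hom (ZFAlgebra.mk setAlgebra isZFAlgebra_setAlgebra) A) :
    IsFold A.toZFData φ.hom := by
  obtain ⟨Z, p, q, hZ, hq⟩ := exists_mem_isGraph
  have hsup : setAlgebra.IsSup q (p ≫ singleton) (𝟙 univ) := by
    refine setAlgebra_isSup_iff.2 fun M d c hc t => ?_
    obtain ⟨-, rfl⟩ := holds_id.1 hc
    constructor
    · intro ht
      obtain ⟨b, hb, hb'⟩ := hZ.surj (mem_univ t) (mem_univ d) ht
      obtain ⟨u, hu⟩ := Holds.exists singleton (mem_univ t)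
      exact ⟨b, u, hb', (holds_comp_iff hb).2 hu, (holds_singleton.1 hu t).2 rfl⟩
    · rintro ⟨b, u, hb, hu, ht⟩
      obtain ⟨x, hx, hu⟩ := holds_comp.1 hu
      obtain rfl := (holds_singleton.1 hu t).1 ht
      exact hZ.rel hx hb
  intro M x c w hc hw
  rw [(ZFData.isSup_iff A.isZFAlgebra.mono_rel).1 (φ.map_sup q _ _ hq hsup)
    ((holds_comp_iff (holds_id.2 ⟨mem_univ x, rfl⟩)).2 hc) hw, Category.assoc]
  have hσ : singleton ≫ φ.hom = φ.hom ≫ A.σ := φ.map_σ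
  rw [hσ]
  constructor
  · intro H y u u' hy hu hu'
    obtain ⟨b, hb, hb'⟩ := hZ.surj (mem_univ y) (mem_univ x) hy
    exact H b u' hb' ((holds_comp_iff hb).2 ((holds_comp_iff hu).2 hu'))
  · intro H b v hb hv
    obtain ⟨y, hy, hv⟩ := holds_comp.1 hv
    obtain ⟨u, hu, hv⟩ := holds_comp.1 hv
    exact H y u v (hZ.rel hy hb) hu hv

/-- The morphism of ZF-algebras defined by a fold. -/
noncomputable def IsFold.toHom (A : ZFAlgebra smallMaps) {h : univ ⟶ A.U}
    (hh : IsFold A.toZFData h) :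
    ZFAlgebra.Hom (ZFAlgebra.mk setAlgebra isZFAlgebra_setAlgebra) A where
  hom := h
  map_le := hh.map_le A.isZFAlgebra
  map_bot := hh.map_bot A.isZFAlgebra
  map_join := hh.map_join A.isZFAlgebra
  map_sup j l s _ := hh.map_sup A.isZFAlgebra j l s
  map_σ := hh.map_σ A.isZFAlgebra

theorem isInitial_setAlgebra :
    Nonempty (IsInitial (ZFAlgebra.mk setAlgebra isZFAlgebra_setAlgebra)) :=
  ⟨IsInitial.ofUniqueHom
    (fun A => IsFold.toHom A (A.isZFAlgebra.exists_isFold).choose_spec)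
    (fun A φ => ZFAlgebra.Hom.ext (A.isZFAlgebra.isFold_unique φ.isFold
      (A.isZFAlgebra.exists_isFold).choose_spec))⟩

end AST

theorem mainTheorem6 :
    AST.IsUniversal AST.DCL.univ ∧
    AST.IsUniverse AST.DCL.smallMaps AST.DCL.univ ∧
    (∃ h : AST.IsZFAlgebra AST.DCL.smallMaps AST.DCL.setAlgebra,
      Nonempty (IsInitial (AST.ZFAlgebra.mk AST.DCL.setAlgebra h))) ∧
    (∀ (X Y : AST.DCL) (F : AST.ClassFun X Y) (L : AST.ClassFun X AST.DCL.univ),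
      AST.DCL.smallMaps (AST.arrow F) →
      ∃ G : AST.ClassFun Y AST.DCL.univ,
        G.toFormula = AST.DCL.unionF (AST.DefClass.formula Y) F.toFormula L.toFormula ∧
        AST.DCL.setAlgebra.IsSup (AST.arrow F) (AST.arrow L) (AST.arrow G)) :=
  ⟨AST.DCL.isUniversal_univ, AST.DCL.isUniverse_univ,
    ⟨AST.DCL.isZFAlgebra_setAlgebra, AST.isInitial_setAlgebra⟩,
    fun _ _ F L hF => AST.DCL.exists_isSup_union F L hF⟩
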